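/- **Theorem.** Let $T$ be a complete NIP theory in a first-order language $L$, let $\kappa>|L|+\aleph_0$, and let $M$ be a $\kappa$-saturated model of $T$; "small" means of cardinality $<\kappa$. Let $G$ be a group definable over $\emptyset$ in $M^{eq}$ (so $G$ is an $\emptyset$-definable set of imaginaries, with $\emptyset$-definable multiplication). A set of tuples (of a fixed, possibly infinite, length) is *type-definable over* $A\subseteq M$ if it is an intersection of sets definable over $A$. A *hyperdefinable set over* $A$ is a quotient $X/E$, where $X$ is a set of tuples of small length and $E$ an equivalence relation on $X$, both type-definable over $A$; its elements are called hyperimaginaries over $A$. Two tuples of hyperimaginaries over $A$ from the same hyperdefinable sets have the same type over $A$ if they have tuples of representatives with the same complete type over $A$. A sequence of tuples of hyperimaginaries is *indiscernible over* $A$ if any two of its finite subsequences of the same length, listed in increasing order of indices, have the same type over $A$. The set $X/E$, hyperdefinable over a small set $A$, is *stable* if for every sequence $(a_i,b_i)_{i<\omega}$ indiscernible over $A$, with all $a_i\in X/E$ and with the $b_i$ arbitrary (tuples of small length, or hyperimaginaries over $A$), we have $\mathrm{tp}(a_i,b_j/A)=\mathrm{tp}(a_j,b_i/A)$ whenever $i\ne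 j$. Then there is a subgroup $G^{st}$ of $G$ such that 1. $G^{st}$ is type-definable over $\emptyset$; 2. the hyperdefinable set $G/G^{st}$ of left cosets, over $\emptyset$, is stable; 3. $G^{st}$ is the smallest subgroup $H$ of $G$ that is type-definable over some small set $A\subseteq M$ and for which $G/H$, as a hyperdefinable set over $A$, is stable. Moreover, $G^{st}$ is a normal subgroup of $G$. -/

import Mathlib

open FirstOrder
open scoped Cardinal

universe u v w w' w''

namespace StableQuotient

variable {L : FirstOrder.Language.{u, v}}

/-- A theory is NIP if in its models no formula `φ(x; y)` (without parameters, `x` and `y` finite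
tuples of variables) shatters arbitrarily large finite sets of tuples. -/
def IsNIP (T : L.Theory) : Prop :=
  ∀ (N : Type w) [L.Structure N] [Nonempty N] [N ⊨ T] (m k : ℕ)
    (φ : L.Formula (Fin m ⊕ Fin k)), ∃ d : ℕ,
      ¬ ∃ (a : Fin d → Fin m → N) (b : Set (Fin d) → Fin k → N),
        ∀ (i : Fin d) (s : Set (Fin d)), φ.Realize (Sum.elim (a i) (b s)) ↔ i ∈ s

/-- `M` is `κ`-saturated: every set of formulas in one variable with parameters from a set of size
less than `κ`, finitely satisfiable in `M`, is realized in `M`. -/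
def IsSaturated (L : FirstOrder.Language.{u, v}) (M : Type w) [L.Structure M] (κ : Cardinal.{w}) : Prop :=
  ∀ A : Set M, #A < κ → ∀ p : Set (L[[A]].Formula Unit),
    (∀ q : Finset (L[[A]].Formula Unit), (q : Set (L[[A]].Formula Unit)) ⊆ p →
      ∃ x : M, ∀ φ ∈ q, φ.Realize (fun _ => x)) →
    ∃ x : M, ∀ φ ∈ p, φ.Realize (fun _ => x)

variable (L) in
/-- A set of (possibly infinite) tuples from `M` is type-definable over `A` if it is an
intersection of sets definable with parameters from `A`. -/
def TypeDefinable {M : Type w} [L.Structure M] (A : Set M) {α : Type w'} (S : Set (α → M)) : Prop :=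
  ∃ 𝒟 : Set (Set (α → M)), (∀ D ∈ 𝒟, A.Definable L D) ∧ S = ⋂₀ 𝒟

/-- The data of a quotient `X/E`: a set `X` of `α`-tuples and an equivalence relation `E`
on `X`. -/
structure QuotientSet (M : Type w) (α : Type w') where
  /-- the set `X` -/
  carrier : Set (α → M)
  /-- the equivalence relation `E` on `X` -/
  rel : Setoid carrier

/-- The set of elements of `X/E`. -/
def QuotientSet.Elem {M : Type w} {α : Type w'} (Q : QuotientSet M α) : Type (max w w') :=
  Quotient Q.rel

/-- The class in `X/E` of an element of `X`. -/
def QuotientSet.cls {M : Type w} {α : Type w'} (Q : QuotientSet M α) (x : Q.carrier) : Q.Elem :=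
  Quotient.mk Q.rel x

variable (L) in
/-- `X/E` is a hyperdefinable set over `A`: both `X` and `E` are type-definable over `A`. -/
def QuotientSet.IsHyperdefinable {M : Type w} [L.Structure M] {α : Type w'}
    (Q : QuotientSet M α) (A : Set M) : Prop :=
  TypeDefinable L A Q.carrier ∧
    TypeDefinable L A {p : α ⊕ α → M | ∃ x y : Q.carrier, Q.rel x y ∧ p = Sum.elim x.1 y.1}

variable (L) in
/-- Equality of types over `A` of two tuples of hyperimaginaries, `(a i, b i)_i` and
`(a' i, b' i)_i`, where `a i, a' i` lie in the hyperdefinable set `P` and `b i, b' i` in `Q`: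
there are tuples of representatives with the same (ordinary) complete type over `A`. In a
sufficiently saturated and homogeneous model this says that some automorphism over `A` takes the
first tuple to the second. -/
def SameType {M : Type w} [L.Structure M] {α : Type w'} {β : Type w''} (A : Set M)
    (P : QuotientSet M α) (Q : QuotientSet M β) {k : Type}
    (a : k → P.Elem) (b : k → Q.Elem) (a' : k → P.Elem) (b' : k → Q.Elem) : Prop :=
  ∃ (x x' : k → P.carrier) (y y' : k → Q.carrier),
    (∀ i, P.cls (x i) = a i ∧ P.cls (x' i) = a' i ∧ Q.cls (y i) = b i ∧ Q.cls (y' i) = b' i) ∧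
    ∀ φ : L[[A]].Formula (k × (α ⊕ β)),
      φ.Realize (fun p => Sum.elim (x p.1).1 (y p.1).1 p.2) ↔
        φ.Realize (fun p => Sum.elim (x' p.1).1 (y' p.1).1 p.2)

variable (L) in
/-- The sequence `(a i, b i)` of pairs of hyperimaginaries, `i < ω`, is indiscernible over `A`. -/
def IsIndiscernible {M : Type w} [L.Structure M] {α : Type w'} {β : Type w''} (A : Set M)
    (P : QuotientSet M α) (Q : QuotientSet M β) (a : ℕ → P.Elem) (b : ℕ → Q.Elem) : Prop :=
  ∀ (n : ℕ) (s t : Fin n → ℕ), StrictMono s → StrictMono t →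
    SameType L A P Q (fun i => a (s i)) (fun i => b (s i)) (fun i => a (t i)) (fun i => b (t i))

variable (L) in
/-- The hyperdefinable set `P`, over `A`, is stable: for every sequence `(a i, b i)`, `i < ω`,
indiscernible over `A` with the `a i` in `P`, the pairs `(a i, b j)` and `(a j, b i)` have the same
type over `A` whenever `i ≠ j`. The `b i` may come from anywhere: they are arbitrary tuples of
length `< κ`, or hyperimaginaries over `A` (in particular imaginaries) represented by such
tuples. -/
def QuotientSet.IsStable {M : Type w} [L.Structure M] {α : Type w'} (κ : Cardinal.{w})
    (P : QuotientSet M α) (A : Set M) : Prop :=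
  P.IsHyperdefinable L A ∧
    ∀ (β : Type w), #β < κ → ∀ Q : QuotientSet M β, Q.IsHyperdefinable L A →
      ∀ (a : ℕ → P.Elem) (b : ℕ → Q.Elem), IsIndiscernible L A P Q a b →
        ∀ i j : ℕ, i ≠ j →
          SameType L A P Q (k := Unit) (fun _ => a i) (fun _ => b j) (fun _ => a j) (fun _ => b i)

/-- A group `G` definable over `∅` in `M^eq`: the elements of `G` are the classes of an
`∅`-definable equivalence relation on an `∅`-definable set `carrier` of `n`-tuples (`proj` is the
quotient map), and the graph of multiplication is `∅`-definable. A group on a definable set of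
`n`-tuples is the case where `proj` is injective. -/
structure DefinableGroup (L : FirstOrder.Language.{u, v}) (M : Type w) [L.Structure M]
    (G : Type w') [Group G] where
  /-- the length of the tuples representing elements of `G` -/
  n : ℕ
  /-- the set of representatives of elements of `G` -/
  carrier : Set (Fin n → M)
  /-- the element of `G` represented by a tuple -/
  proj : carrier → G
  proj_surjective : Function.Surjective proj
  carrier_definable : (∅ : Set M).Definable L carrier
  eq_definable : (∅ : Set M).Definable L
    {p : Fin n ⊕ Fin n → M | ∃ x y : carrier, proj x = proj y ∧ p = Sum.elim x.1 y.1}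
  mul_definable : (∅ : Set M).Definable L
    {p : Fin n ⊕ (Fin n ⊕ Fin n) → M | ∃ x y z : carrier,
      proj x * proj y = proj z ∧ p = Sum.elim x.1 (Sum.elim y.1 z.1)}

namespace DefinableGroup

variable {M : Type w} [L.Structure M] {G : Type w'} [Group G]

/-- The subset `S` of `G` is type-definable over `A` (equivalently, the set of tuples representing
elements of `S` is). -/
def TypeDefinable (D : DefinableGroup L M G) (A : Set M) (S : Set G) : Prop :=
  StableQuotient.TypeDefinable L A ((↑) '' (D.proj ⁻¹' S) : Set (Fin D.n → M))

/-- The set of left cosets `G/H` as a quotient of a set of tuples from `M`: the tuples `x` and `y`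
are identified when they represent elements in the same left coset of `H`. -/
def coset (D : DefinableGroup L M G) (H : Subgroup G) : QuotientSet M (Fin D.n) where
  carrier := D.carrier
  rel := (QuotientGroup.leftRel H).comap D.proj

end DefinableGroup

end StableQuotient

/-! Stability of `G/H` is replaced by a local condition, `StableSub`: for a definable family `P` and
a definable `U ⊇ H` there is a bound on the length of patterns in which `g i ∈ P (b j)` for `j < i`,
while `g i * U` misses `P (b j)` for `i < j`. For `H` type-definable over a small set this is
equivalent to stability of `G/H` (`stableSub_of_isStable`, `isStable_of_stableSub`). It mentions no
base set, sees `H` only through its definable neighbourhoods, and passes to conjugates, to finite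
intersections (`Good.inf`) and, by compactness, to the infinite intersections needed below.

The main tool is `Good.exists_shift`. If `H` is good and the `g` at one place of every increasing
configuration satisfies a definable relation with the `b` at the other places, then, on a
subsequence, the `g` at any earlier place satisfies it too after right multiplication by an element
of a prescribed neighbourhood of `H`. Otherwise Ramsey's theorem gives a pair of adjacent places
that cannot be exchanged, and this is a forbidden order pattern.

NIP serves to remove parameters. Let `H` be good and `V ⊇ H` definable. A chain of definable
neighbourhoods of `H`, each containing the square of the next, intersects in a subgroup `K_c` with
`H ≤ K_c ⊆ V`, described by a countable tuple `c`. For every realization `c'` of the type of `c`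
over `∅`, `K_c'` is again good. At each level of the chain finitely many of these subgroups
determine the intersection of all of them: otherwise there are `g i ∈ K_(c j)` for all `j < i` with
`g i` outside a fixed neighbourhood of parameter `c i`. If membership (at a deep level) also held
for `j > i`, the products of subsets of the `g i` would shatter the `c i`; the shift is what reduces
the one-sided situation to this two-sided one (`not_exists_seq`). So the intersection of all `K_c'`
is a countable intersection of good subgroups, hence stable, and it is type-definable over `∅`.

Thus every definable `V` containing a good subgroup contains a stable subgroup type-definable over
`∅`, and the intersection of all the latter is the least good subgroup. It is normal because
conjugates of good subgroups are good. -/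

set_option linter.unusedSectionVars false
set_option linter.unusedVariables false

namespace StableQuotient

/-! ### Closure properties of definable predicates on possibly infinite tuples -/

section Definability

variable {L : FirstOrder.Language.{u, v}} {M : Type w} [L.Structure M] {A B : Set M}
  {γ : Type*} {γ' : Type*}

variable (L) in
/-- A predicate on `γ`-tuples is definable with parameters in `A`. -/
def DefPred (A : Set M) (p : (γ → M) → Prop) : Prop := A.Definable L {z | p z}

namespace DefPred

variable {p q : (γ → M) → Prop}

theorem mono (h : DefPred L A p) (hAB : A ⊆ B) : DefPred L B p := Set.Definable.mono h hAB

theorem and (hp : DefPred L A p) (hq : DefPred L A q) : DefPred L A (fun z => p z ∧ q z) :=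
  Set.Definable.inter hp hq

theorem or (hp : DefPred L A p) (hq : DefPred L A q) : DefPred L A (fun z => p z ∨ q z) :=
  Set.Definable.union hp hq

theorem not (hp : DefPred L A p) : DefPred L A (fun z => ¬ p z) :=
  Set.Definable.compl hp

theorem imp (hp : DefPred L A p) (hq : DefPred L A q) : DefPred L A (fun z => p z → q z) := by
  simp only [imp_iff_not_or]
  exact hp.not.or hq

theorem iff (hp : DefPred L A p) (hq : DefPred L A q) : DefPred L A (fun z => p z ↔ q z) := by
  simp only [iff_iff_implies_and_implies]
  exact (hp.imp hq).and (hq.imp hp)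

theorem const (P : Prop) : DefPred L A (fun _ : γ → M => P) := by
  by_cases h : P
  · simp only [h]; exact Set.definable_univ
  · simp only [h]; exact Set.definable_empty

theorem congr (hp : DefPred L A p) (h : ∀ z, p z ↔ q z) : DefPred L A q := by
  rwa [show q = p from funext fun z => propext (h z).symm]

theorem finite_all {ι : Type*} [Finite ι] {p : ι → (γ → M) → Prop}
    (h : ∀ i, DefPred L A (p i)) : DefPred L A (fun z => ∀ i, p i z) := by
  have := Set.definable_iInter_of_finite h
  refine (show DefPred L A (fun z => z ∈ ⋂ i, {z | p i z}) from this).congr fun z => ?_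
  simp

theorem all_of_imp_fin {s : ℕ → Prop} {p : ℕ → (γ → M) → Prop} {N : ℕ}
    (hs : ∀ i, s i → i < N)
    (h : ∀ i, DefPred L A (p i)) : DefPred L A (fun z => ∀ i, s i → p i z) := by
  refine (finite_all (p := fun (i : Fin N) z => s i → p i z)
    fun i => (const _).imp (h i)).congr fun z => ?_
  exact ⟨fun H i hi => H ⟨i, hs i hi⟩ hi, fun H i hi => H i hi⟩

theorem comp (hp : DefPred L A p) (e : γ → γ') : DefPred L A (fun z : γ' → M => p (z ∘ e)) :=
  Set.Definable.preimage_comp e hp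

theorem eq (i j : γ) : DefPred L A (fun z : γ → M => z i = z j) := by
  refine ⟨(Language.Term.var i).equal (Language.Term.var j), ?_⟩
  ext z
  simp

theorem eq_const (i : γ) {a : M} (ha : a ∈ A) : DefPred L A (fun z : γ → M => z i = a) := by
  refine ⟨(Language.Term.var i).equal (L.con (⟨a, ha⟩ : A)).term, ?_⟩
  ext z
  simp

/-- A formula involves finitely many of the quantified variables, so quantification over an infinite
tuple is first-order; the other coordinates are filled in arbitrarily, whence `Nonempty M`. -/
theorem ex [Nonempty M] {p : (γ → M) → (γ' → M) → Prop}
    (h : DefPred L A (fun z : γ ⊕ γ' → M => p (z ∘ Sum.inl) (z ∘ Sum.inr))) :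
    DefPred L A (fun z => ∃ w, p z w) := by
  classical
  obtain ⟨φ, hφ⟩ := h
  have hφ' : ∀ z w, p z w ↔ φ.Realize (Sum.elim z w) := fun z w => by
    have := Set.ext_iff.1 hφ (Sum.elim z w)
    simpa using this
  let T := {j : γ' // Sum.inr j ∈ φ.freeVarFinset}
  have : Finite T := Finite.of_injective
    (fun j : T => (⟨Sum.inr j.1, j.2⟩ : φ.freeVarFinset)) (fun a b hab =>
      Subtype.ext (Sum.inr_injective (congrArg Subtype.val hab)))
  let f : φ.freeVarFinset → γ ⊕ T := fun x => match x with
    | ⟨Sum.inl i, _⟩ => Sum.inl i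
    | ⟨Sum.inr j, hj⟩ => Sum.inr ⟨j, hj⟩
  have key : ∀ (z : γ → M) (w : γ' → M), (φ.restrictFreeVar f).Realize (Sum.elim z (fun j : T => w j.1)) default ↔
      φ.Realize (Sum.elim z w) := fun z w => by
    refine Language.BoundedFormula.realize_restrictFreeVar _ ?_
    rintro ⟨i | j, hj⟩ <;> rfl
  have := Set.Definable.exists_of_finite (A := A) (L := L) (S := {z : γ ⊕ T → M |
    (φ.restrictFreeVar f).Realize z default}) ⟨φ.restrictFreeVar f, by
      ext z; exact Iff.rfl⟩
  refine (show DefPred L A _ from this).congr fun z => ?_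
  constructor
  · rintro ⟨u, hu⟩
    let w : γ' → M := fun j => if h : Sum.inr j ∈ φ.freeVarFinset then u ⟨j, h⟩ else Classical.arbitrary M
    refine ⟨w, (hφ' _ _).2 ((key z w).1 ?_)⟩
    have : (fun j : T => w j.1) = u := by
      funext j
      simp [w, j.2]
    rw [this]
    exact hu
  · rintro ⟨w, hw⟩
    exact ⟨fun j => w j.1, (key z w).2 ((hφ' _ _).1 hw)⟩

theorem all [Nonempty M] {p : (γ → M) → (γ' → M) → Prop}
    (h : DefPred L A (fun z : γ ⊕ γ' → M => p (z ∘ Sum.inl) (z ∘ Sum.inr))) :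
    DefPred L A (fun z => ∀ w, p z w) := by
  refine (ex (p := fun z w => ¬ p z w) h.not).not.congr fun z => ?_
  push Not
  rfl

/-- A definable predicate depends on finitely many coordinates and finitely many parameters. -/
theorem exists_support (hp : DefPred L A p) :
    ∃ (T : Finset (A ⊕ γ)) (p₀ : (T → M) → Prop), DefPred L (∅ : Set M) p₀ ∧
      ∀ z, p z ↔ p₀ (fun i => Sum.elim (↑) z i.1) := by
  classical
  obtain ⟨φ, hφ⟩ := Set.definable_iff_exists_formula_sum.1 hp
  refine ⟨φ.freeVarFinset, fun z => (φ.restrictFreeVar id).Realize z default, ?_, fun z => ?_⟩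
  · exact Set.empty_definable_iff.2 ⟨φ.restrictFreeVar id, rfl⟩
  · refine (Set.ext_iff.1 hφ z).trans ?_
    exact (Language.BoundedFormula.realize_restrictFreeVar (φ := φ) (f := id) _ (fun _ => rfl)).symm

/-- Substituting parameters for some of the variables. -/
theorem subst {p : (γ ⊕ γ' → M) → Prop} (hp : DefPred L A p) (hAB : A ⊆ B) (a : γ' → M)
    (ha : ∀ i, a i ∈ B) : DefPred L B (fun z => p (Sum.elim z a)) := by
  obtain ⟨φ, hφ⟩ := Set.definable_iff_exists_formula_sum.1 (hp.mono hAB)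
  refine Set.definable_iff_exists_formula_sum.2 ⟨φ.relabel (Sum.elim Sum.inl
    (Sum.elim Sum.inr fun i => Sum.inl ⟨a i, ha i⟩)), ?_⟩
  ext z
  refine (Set.ext_iff.1 hφ (Sum.elim z a)).trans ?_
  simp only [Set.mem_ofPred_eq, Language.Formula.realize_relabel]
  refine iff_of_eq (congrArg _ ?_)
  funext i
  rcases i with i | i | i <;> rfl

theorem exists_countable {A : Set M} (hp : DefPred L A p) :
    ∃ B : Set M, B ⊆ A ∧ B.Countable ∧ DefPred L B p := by
  obtain ⟨A₀, h₀, h⟩ := Set.definable_iff_finitely_definable.1 hp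
  exact ⟨A₀, h₀, A₀.countable_toSet, h⟩

end DefPred

/-- Two tuples satisfy the same formulas over `A`. -/
def EqType (L : FirstOrder.Language.{u, v}) {M : Type w} [L.Structure M] (A : Set M)
    {γ : Type*} (x y : γ → M) : Prop :=
  ∀ p : (γ → M) → Prop, DefPred L A p → p x → p y

theorem EqType.iff {x y : γ → M} (h : EqType L A x y) {p : (γ → M) → Prop}
    (hp : DefPred L A p) : p x ↔ p y :=
  ⟨h p hp, fun hy => by_contra fun hx => h _ hp.not hx hy⟩

theorem EqType.symm {x y : γ → M} (h : EqType L A x y) : EqType L A y x :=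
  fun _ hp => (h.iff hp).2

theorem EqType.trans {x y z : γ → M} (h : EqType L A x y) (h' : EqType L A y z) :
    EqType L A x z :=
  fun p hp hx => h' p hp (h p hp hx)

theorem EqType.comp {x y : γ' → M} (h : EqType L A x y) (e : γ → γ') :
    EqType L A (x ∘ e) (y ∘ e) :=
  fun _ hp => h _ (hp.comp e)

theorem eqType_iff_formula {x y : γ → M} :
    EqType L A x y ↔ ∀ φ : L[[A]].Formula γ, φ.Realize x ↔ φ.Realize y :=
  ⟨fun h φ => h.iff (p := φ.Realize) ⟨φ, rfl⟩, fun h p hp hx => by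
    obtain ⟨φ, hφ⟩ := hp
    exact (Set.ext_iff.1 hφ y).2 ((h φ).1 ((Set.ext_iff.1 hφ x).1 hx))⟩

end Definability

/-! ### From saturation in one variable to fewer than `κ` variables -/

section Compactness

variable {L : FirstOrder.Language.{u, v}} {M : Type w} [L.Structure M]
  {κ : Cardinal.{w}}

theorem IsSaturated.exists_unary (hM : IsSaturated L M κ) {A : Set M} (hA : #A < κ)
    (P : Set (M → Prop)) (hdef : ∀ p ∈ P, DefPred L A (fun z : Unit → M => p (z ())))
    (hfin : ∀ Q : Finset (M → Prop), (Q : Set (M → Prop)) ⊆ P → ∃ m, ∀ p ∈ Q, p m) :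
    ∃ m, ∀ p ∈ P, p m := by
  classical
  let Φ : Set (L[[A]].Formula Unit) := {φ | (fun m : M => φ.Realize (fun _ => m)) ∈ P}
  obtain ⟨m, hm⟩ := hM A hA Φ (fun q hq => by
    obtain ⟨m, hm⟩ := hfin (q.image fun φ m => φ.Realize (fun _ => m)) (by
      intro p hp
      simp only [Finset.coe_image, Set.mem_image] at hp
      obtain ⟨φ, hφ, rfl⟩ := hp
      exact hq hφ)
    exact ⟨m, fun φ hφ => hm _ (Finset.mem_image_of_mem _ hφ)⟩)
  refine ⟨m, fun p hp => ?_⟩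
  obtain ⟨φ, hφ⟩ := hdef p hp
  have h : ∀ m, p m ↔ φ.Realize (fun _ => m) := fun m => Set.ext_iff.1 hφ (fun _ => m)
  refine (h m).2 (hm φ ?_)
  have : (fun m : M => φ.Realize (fun _ => m)) = p := funext fun m => propext (h m).symm
  exact (congrArg (· ∈ P) this).mpr hp

/-- In a `κ`-saturated model, types in fewer than `κ` variables over fewer than `κ` parameters
are realized. -/
theorem IsSaturated.compactness [Nonempty M] (hM : IsSaturated L M κ) (hκ : ℵ₀ ≤ κ) {γ : Type w''}
    (hγ : Cardinal.lift.{w} #γ < Cardinal.lift.{w''} κ)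
    {B : Set M} (hB : #B < κ) {ι : Type*} (p : ι → (γ → M) → Prop)
    (hdef : ∀ i, DefPred L B (p i)) (hfin : ∀ s : Finset ι, ∃ z, ∀ i ∈ s, p i z) :
    ∃ z, ∀ i, p i z := by
  classical
  let 𝒮 : Set (Set (γ → M)) := Set.range fun i => {z | p i z}
  have : (Filter.generate 𝒮).NeBot := Filter.generate_neBot_iff.2 fun t ht htf => by
    have ht' : ∀ s : t, ∃ i, {z | p i z} = s.1 := fun s => ht s.2
    choose f hf using ht'
    have := htf.fintype
    obtain ⟨z, hz⟩ := hfin (Finset.univ.image f)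
    refine ⟨z, fun s hs => ?_⟩
    rw [show s = _ from (hf ⟨s, hs⟩).symm]
    exact hz _ (Finset.mem_image_of_mem _ (Finset.mem_univ _))
  -- The conditions over `B` that hold `𝒰`-almost everywhere form a complete type extending the
  -- given one; it is this type that gets realized.
  let 𝒰 := Ultrafilter.of (Filter.generate 𝒮)
  have h𝒰 : ∀ i, ∀ᶠ z in (𝒰 : Filter (γ → M)), p i z := fun i =>
    Ultrafilter.of_le _ (Filter.mem_generate_of_mem ⟨i, rfl⟩)
  -- An element `(i, m)` of `R` prescribes the value `m` at the coordinate `i`. A maximal set of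
  -- prescriptions finitely consistent with the type is the graph of a realization.
  let Good : Set (Set (γ × M)) := {R | ∀ q : (γ → M) → Prop, DefPred L B q →
    (∀ᶠ z in (𝒰 : Filter (γ → M)), q z) → ∀ R₀ : Finset (γ × M), (R₀ : Set (γ × M)) ⊆ R →
      ∃ z, q z ∧ ∀ r ∈ R₀, z r.1 = r.2}
  obtain ⟨R, -, hR⟩ := zorn_subset_nonempty Good (fun c hc hchain hne => by
    refine ⟨⋃₀ c, fun q hq hq' R₀ hR₀ => ?_, fun s hs => Set.subset_sUnion_of_mem hs⟩
    obtain ⟨R, hRc, hRR⟩ := hchain.directedOn.exists_mem_subset_of_finset_subset_biUnion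
      hne (by simpa [Set.sUnion_eq_biUnion] using hR₀)
    exact hc hRc q hq hq' R₀ hRR) ∅ (fun q hq hq' R₀ hR₀ => by
      obtain ⟨z, hz⟩ := hq'.exists
      refine ⟨z, hz, fun r hr => ?_⟩
      exact absurd (hR₀ hr) (by simp))
  have hfun : ∀ i m m', (i, m) ∈ R → (i, m') ∈ R → m = m' := fun i m m' h h' => by
    obtain ⟨z, -, hz⟩ := hR.1 (fun _ => True) (DefPred.const _) (by simp) {(i, m), (i, m')} (by
      intro x hx
      simp only [Finset.coe_insert, Finset.coe_singleton, Set.mem_insert_iff,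
        Set.mem_singleton_iff] at hx
      rcases hx with rfl | rfl <;> assumption)
    exact (hz (i, m) (by simp)).symm.trans (hz (i, m') (by simp))
  have htot : ∀ i, ∃ m, (i, m) ∈ R := fun i => by
    let B' := B ∪ Prod.snd '' R
    -- Since `R` is the graph of a partial function, the values already used inject into the set of
    -- variables.
    have hB' : #B' < κ := by
      refine (Cardinal.mk_union_le _ _).trans_lt (Cardinal.add_lt_of_lt hκ hB ?_)
      have h : ∀ m : Prod.snd '' R, ∃ i, (i, m.1) ∈ R := by
        rintro ⟨_, ⟨i, m⟩, hm, rfl⟩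
        exact ⟨i, hm⟩
      choose f hf using h
      refine Cardinal.lift_lt.1 (lt_of_le_of_lt ?_ hγ)
      exact Cardinal.lift_mk_le_lift_mk_of_injective (f := f) fun m m' hmm =>
        Subtype.ext (hfun (f m) _ _ (hf m) (hmm ▸ hf m'))
    let P : Set (M → Prop) := {f | ∃ q : (γ → M) → Prop, DefPred L B q ∧
      (∀ᶠ z in (𝒰 : Filter (γ → M)), q z) ∧ ∃ R₀ : Finset (γ × M), (R₀ : Set (γ × M)) ⊆ R ∧
        f = fun m => ∃ z, (q z ∧ ∀ r : R₀, z r.1.1 = r.1.2) ∧ z i = m}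
    obtain ⟨m, hm⟩ := hM.exists_unary hB' P (by
      rintro _ ⟨q, hq, -, R₀, hR₀, rfl⟩
      refine DefPred.ex (γ' := γ) (p := fun (m : Unit → M) z =>
        (q z ∧ ∀ r : R₀, z r.1.1 = r.1.2) ∧ z i = m ()) ?_
      refine (((hq.mono Set.subset_union_left).comp Sum.inr).and (DefPred.finite_all fun r => ?_)).and
        (DefPred.eq (Sum.inr i) (Sum.inl ()))
      exact DefPred.eq_const (Sum.inr r.1.1)
        (Set.subset_union_right ⟨r.1, hR₀ r.2, rfl⟩)) (by
      intro Q hQ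
      have hQ' : ∀ f : Q, _ := fun f => hQ f.2
      choose q hq hq' R₀ hR₀ hf using hQ'
      obtain ⟨z, hz, hz'⟩ := hR.1 (fun z => ∀ f : Q, q f z)
        (DefPred.finite_all hq) (Filter.eventually_all.2 hq') (Q.attach.biUnion R₀) (by
          intro r hr
          simp only [Finset.coe_biUnion, Set.mem_iUnion] at hr
          obtain ⟨f, -, hr⟩ := hr
          exact hR₀ f hr)
      refine ⟨z i, fun f hf' => ?_⟩
      rw [show f = _ from hf ⟨f, hf'⟩]
      refine ⟨z, ⟨hz ⟨f, hf'⟩, fun r => hz' _ ?_⟩, rfl⟩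
      exact Finset.mem_biUnion.2 ⟨⟨f, hf'⟩, Finset.mem_attach _ _, r.2⟩)
    refine ⟨m, hR.2 (y := insert (i, m) R) (fun q hq hq' R₀ hR₀ => ?_)
      (Set.subset_insert _ _) (Set.mem_insert _ _)⟩
    obtain ⟨z, ⟨hz, hz'⟩, hzi⟩ := hm _ ⟨q, hq, hq', R₀.erase (i, m), (by
      intro r hr
      simp only [Finset.coe_erase, Set.mem_sdiff, Set.mem_singleton_iff] at hr
      exact (hR₀ hr.1).resolve_left hr.2), rfl⟩
    refine ⟨z, hz, fun r hr => ?_⟩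
    by_cases h : r = (i, m)
    · subst h; exact hzi
    · exact hz' ⟨r, Finset.mem_erase.2 ⟨h, hr⟩⟩
  choose z hz using htot
  refine ⟨z, fun i => ?_⟩
  obtain ⟨T, p₀, -, hp₀⟩ := (hdef i).exists_support
  obtain ⟨y, hy, hyz⟩ := hR.1 (p i) (hdef i) (h𝒰 i)
    (T.toRight.image fun j => (j, z j)) (by
      intro r hr
      simp only [Finset.coe_image, Set.mem_image] at hr
      obtain ⟨j, -, rfl⟩ := hr
      exact hz j)
  rw [hp₀] at hy ⊢
  convert hy using 2 with t
  rcases t with ⟨a | j, ht⟩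
  · rfl
  · exact (hyz (j, z j) (Finset.mem_image_of_mem _ (by simpa using ht))).symm

end Compactness

/-! ### Ramsey's theorem -/

section Ramsey

theorem exists_strictMono_const (b : ℕ → Prop) :
    ∃ f : ℕ → ℕ, StrictMono f ∧ ((∀ n, b (f n)) ∨ ∀ n, ¬ b (f n)) := by
  by_cases h : ∃ᶠ n in Filter.atTop, b n
  · obtain ⟨f, hf, hb⟩ := Filter.extraction_of_frequently_atTop h
    exact ⟨f, hf, Or.inl hb⟩
  · rw [Filter.not_frequently] at h
    obtain ⟨f, hf, hb⟩ := Filter.extraction_of_frequently_atTop h.frequently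
    exact ⟨f, hf, Or.inr hb⟩

/-- Infinite Ramsey theorem for two colours. -/
theorem ramsey : ∀ (k : ℕ) (c : (Fin k → ℕ) → Prop), ∃ f : ℕ → ℕ, StrictMono f ∧
    ((∀ s, StrictMono s → c (f ∘ s)) ∨ ∀ s, StrictMono s → ¬ c (f ∘ s))
  | 0, c => by
    refine ⟨id, strictMono_id, ?_⟩
    by_cases h : c default
    · exact Or.inl fun s _ => by rwa [Subsingleton.elim (id ∘ s) default]
    · exact Or.inr fun s _ => by rwa [Subsingleton.elim (id ∘ s) default]
  | k + 1, c => by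
    let St := {h : ℕ → ℕ // StrictMono h}
    have step : ∀ h : St, ∃ g : ℕ → ℕ, StrictMono g ∧ ∃ b : Prop, ∀ s, StrictMono s →
        (c (Fin.cons (h.1 0) ((h.1 ∘ Nat.succ ∘ g) ∘ s)) ↔ b) := fun h => by
      obtain ⟨g, hg, h' | h'⟩ := ramsey k (fun s => c (Fin.cons (h.1 0) ((h.1 ∘ Nat.succ) ∘ s)))
      · exact ⟨g, hg, True, fun s hs => iff_true_intro (h' s hs)⟩
      · exact ⟨g, hg, False, fun s hs => iff_false_intro (h' s hs)⟩
    choose g hg b hb using step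
    have hsucc : StrictMono Nat.succ := fun _ _ => Nat.succ_lt_succ
    -- The maps `H m` enumerate a decreasing sequence of infinite sets, and `F` collects their first
    -- elements: the colour of an increasing tuple from the range of `F` depends on its first entry
    -- only.
    let next : St → St := fun h => ⟨h.1 ∘ Nat.succ ∘ g h, h.2.comp (hsucc.comp (hg h))⟩
    let H : ℕ → St := fun m => next^[m] ⟨id, strictMono_id⟩
    have hH : ∀ m, H (m + 1) = next (H m) := fun m => Function.iterate_succ_apply' _ _ _
    let F : ℕ → ℕ := fun m => (H m).1 0
    have hF : StrictMono F := strictMono_nat_of_lt_succ fun m => by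
      simp only [F, hH]
      exact (H m).2 (Nat.succ_pos _)
    have hsub : ∀ m j, ∃ e, (H (m + j)).1 0 = (H m).1 e := by
      intro m j
      have : ∀ e, ∃ e', (H (m + j)).1 e = (H m).1 e' := by
        induction j with
        | zero => exact fun e => ⟨e, rfl⟩
        | succ j ih =>
          intro e
          rw [← add_assoc, hH]
          exact ih _
      exact this 0
    have hcol : ∀ m (s : Fin k → ℕ), StrictMono s → (∀ q, m < s q) →
        (c (Fin.cons (F m) (F ∘ s)) ↔ b (H m)) := fun m s hs hms => by
      have : ∀ q, ∃ e, F (s q) = (next (H m)).1 e := fun q => by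
        obtain ⟨j, hj⟩ := Nat.exists_eq_add_of_lt (hms q)
        obtain ⟨e, he⟩ := hsub (m + 1) j
        refine ⟨e, ?_⟩
        rw [← hH, ← he, hj]
        simp only [F, show m + j + 1 = m + 1 + j by omega]
      choose e he using this
      have hes : StrictMono e := fun q q' hq => by
        have := hF (hs hq)
        rw [he, he] at this
        exact (next (H m)).2.lt_iff_lt.1 this
      rw [← hb (H m) e hes]
      have : F ∘ s = ((H m).1 ∘ Nat.succ ∘ g (H m)) ∘ e := funext he
      rw [this]
    obtain ⟨f, hf, hfb⟩ := exists_strictMono_const (fun m => b (H m))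
    refine ⟨F ∘ f, hF.comp hf, ?_⟩
    have main : ∀ s : Fin (k + 1) → ℕ, StrictMono s → (c ((F ∘ f) ∘ s) ↔ b (H (f (s 0)))) :=
      fun s hs => by
        rw [← hcol (f (s 0)) (fun q => f (s q.succ))
          (fun q q' hq => hf (hs (Fin.succ_lt_succ_iff.2 hq)))
          (fun q => hf (hs (Fin.succ_pos q)))]
        refine iff_of_eq (congrArg c ?_)
        funext q
        refine Fin.cases ?_ (fun q => ?_) q <;> simp
    rcases hfb with hfb | hfb
    · exact Or.inl fun s hs => (main s hs).2 (hfb _)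
    · exact Or.inr fun s hs h => hfb _ ((main s hs).1 h)

/-- Finitely many hereditary properties of subsequences, each attainable below every
subsequence, are attained together. -/
theorem exists_strictMono_forall_finset {ι : Type*} (s : Finset ι) (R : ι → (ℕ → ℕ) → Prop)
    (hered : ∀ i ∈ s, ∀ f g : ℕ → ℕ, StrictMono g → R i f → R i (f ∘ g))
    (att : ∀ i ∈ s, ∀ f : ℕ → ℕ, StrictMono f → ∃ g, StrictMono g ∧ R i (f ∘ g)) :
    ∃ f : ℕ → ℕ, StrictMono f ∧ ∀ i ∈ s, R i f := by
  classical
  induction s using Finset.induction_on with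
  | empty => exact ⟨id, strictMono_id, by simp⟩
  | insert a s ha ih =>
    obtain ⟨f, hf, h⟩ := ih (fun i hi => hered i (Finset.mem_insert_of_mem hi))
      (fun i hi => att i (Finset.mem_insert_of_mem hi))
    obtain ⟨g, hg, h'⟩ := att a (Finset.mem_insert_self _ _) f hf
    refine ⟨f ∘ g, hf.comp hg, fun i hi => ?_⟩
    rcases Finset.mem_insert.1 hi with rfl | hi'
    · exact h'
    · exact hered i hi f g hg (h i hi')

/-- Ramsey's theorem for finitely many colourings at once. -/
theorem ramsey_finset {ι : Type*} (S : Finset ι) (k : ι → ℕ) (c : ∀ i, (Fin (k i) → ℕ) → Prop) :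
    ∃ f : ℕ → ℕ, StrictMono f ∧ ∀ i ∈ S,
      ((∀ s, StrictMono s → c i (f ∘ s)) ∨ ∀ s, StrictMono s → ¬ c i (f ∘ s)) := by
  refine exists_strictMono_forall_finset S (fun i f =>
    ((∀ s, StrictMono s → c i (f ∘ s)) ∨ ∀ s, StrictMono s → ¬ c i (f ∘ s))) ?_ ?_
  · rintro i - f g hg (h | h)
    · exact Or.inl fun s hs => h _ (hg.comp hs)
    · exact Or.inr fun s hs => h _ (hg.comp hs)
  · intro i _ f _
    obtain ⟨g, hg, h⟩ := ramsey (k i) (fun s => c i (f ∘ s))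
    exact ⟨g, hg, h⟩

end Ramsey

/-! ### Extending equality of types, and finite subconjunctions -/

section Homogeneity

variable {L : FirstOrder.Language.{u, v}} {M : Type w} [L.Structure M]
  {κ : Cardinal.{w}}

theorem mk_union_lt {A B : Set M} (hκ : ℵ₀ ≤ κ) (hA : #A < κ) (hB : #B < κ) :
    #(A ∪ B : Set M) < κ :=
  (Cardinal.mk_union_le _ _).trans_lt (Cardinal.add_lt_of_lt hκ hA hB)

theorem mk_lt_of_countable {A : Set M} (hκ : ℵ₀ < κ) (hA : A.Countable) : #A < κ :=
  (Cardinal.le_aleph0_iff_set_countable.2 hA).trans_lt hκ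

theorem lift_mk_lt_of_countable (hκ : ℵ₀ < κ) (γ : Type w'') [Countable γ] :
    Cardinal.lift.{w} #γ < Cardinal.lift.{w''} κ := by
  refine lt_of_le_of_lt (b := ℵ₀) ?_ (by simpa using hκ)
  simp

variable [Nonempty M]

/-- The compactness principle for countably many variables. -/
theorem IsSaturated.compactness_countable (hM : IsSaturated L M κ) (hκ : ℵ₀ < κ) {γ : Type w''}
    [Countable γ] {B : Set M} (hB : #B < κ) {ι : Type*} (p : ι → (γ → M) → Prop)
    (hdef : ∀ i, DefPred L B (p i)) (hfin : ∀ s : Finset ι, ∃ z, ∀ i ∈ s, p i z) :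
    ∃ z, ∀ i, p i z :=
  hM.compactness hκ.le (lift_mk_lt_of_countable hκ γ) hB p hdef hfin

/-- Substitute for an automorphism over `A` taking `x` to `x'`: finite parts of the type of `y` over
`A` and `x` are transported by existential quantification, and saturation does the rest. -/
theorem IsSaturated.exists_eqType_extend (hM : IsSaturated L M κ) (hκ : ℵ₀ ≤ κ) {A : Set M}
    (hA : #A < κ) {γ : Type*} {γ' : Type w''} {x : γ → M} {x' : γ → M}
    (hx : #(Set.range x') < κ)
    (hγ' : Cardinal.lift.{w} #γ' < Cardinal.lift.{w''} κ)
    (h : EqType L A x x') (y : γ' → M) :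
    ∃ y' : γ' → M, EqType L A (Sum.elim x y) (Sum.elim x' y') := by
  let ι := {p : (γ ⊕ γ' → M) → Prop // DefPred L A p ∧ p (Sum.elim x y)}
  obtain ⟨y', hy'⟩ := hM.compactness hκ hγ' (mk_union_lt hκ hA hx)
    (fun (i : ι) y' => i.1 (Sum.elim x' y')) (fun i => by
      have := (i.2.1.comp Sum.swap).subst (B := A ∪ Set.range x') Set.subset_union_left x'
        (fun i => Or.inr ⟨i, rfl⟩)
      refine this.congr fun z => iff_of_eq (congrArg _ ?_)
      funext j
      rcases j with j | j <;> rfl) (fun s => by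
      refine h (fun x => ∃ y, ∀ i ∈ s, i.1 (Sum.elim x y)) (DefPred.ex ?_) ⟨y, fun i _ => i.2.2⟩
      refine (DefPred.finite_all (p := fun (i : s) z => i.1.1 z) fun i => i.1.2.1).congr
        fun z => ?_
      rw [Sum.elim_comp_inl_inr]
      exact ⟨fun H i hi => H ⟨i, hi⟩, fun H i => H i.1 i.2⟩)
  exact ⟨y', fun p hp hpx => hy' ⟨p, hp, hpx⟩⟩

end Homogeneity

section Separation

variable {L : FirstOrder.Language.{u, v}} {M : Type w} [L.Structure M] [Nonempty M]
  {κ : Cardinal.{w}}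

/-- If a small conjunction of definable conditions implies a definable condition, then a finite
subconjunction does. -/
theorem IsSaturated.exists_finset (hM : IsSaturated L M κ) (hκ : ℵ₀ < κ) {γ : Type w''}
    (hγ : Cardinal.lift.{w} #γ < Cardinal.lift.{w''} κ) {A : Set M} (hA : #A < κ) {ι : Type*}
    {p : ι → (γ → M) → Prop} (hp : ∀ i, DefPred L A (p i)) {q : (γ → M) → Prop}
    (hq : DefPred L Set.univ q) (h : ∀ z, (∀ i, p i z) → q z) :
    ∃ s : Finset ι, ∀ z, (∀ i ∈ s, p i z) → q z := by
  classical
  by_contra! hcon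
  obtain ⟨B, -, hB, hqB⟩ := hq.exists_countable
  obtain ⟨z, hz⟩ := hM.compactness hκ.le hγ (mk_union_lt hκ.le hA (mk_lt_of_countable hκ hB))
    (fun (i : Option ι) => i.elim (fun z => ¬ q z) p) (fun i => by
      cases i with
      | none => exact (hqB.mono Set.subset_union_right).not
      | some i => exact (hp i).mono Set.subset_union_left) (fun s => by
      obtain ⟨z, hz, hqz⟩ := hcon s.eraseNone
      refine ⟨z, fun i hi => ?_⟩
      cases i with
      | none => exact hqz
      | some i => exact hz i (Finset.mem_eraseNone.2 hi))
  exact hz none (h z fun i => hz (some i))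

end Separation

/-! ### Definability calculus for elements and subsets of `G` -/

namespace DefinableGroup

variable {L : FirstOrder.Language.{u, v}} {M : Type w} [L.Structure M]
  {G : Type w'} [Group G] (D : DefinableGroup L M G) {A B : Set M} {γ : Type*} {γ' : Type*}

open Classical in
/-- The element of `G` represented by a tuple, and `1` if there is none. -/
noncomputable def rd (x : Fin D.n → M) : G := if h : x ∈ D.carrier then D.proj ⟨x, h⟩ else 1

theorem rd_coe (x : D.carrier) : D.rd x.1 = D.proj x := dif_pos x.2

theorem rd_of_mem {x : Fin D.n → M} (h : x ∈ D.carrier) : D.rd x = D.proj ⟨x, h⟩ := dif_pos h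

theorem exists_rd (g : G) : ∃ x ∈ D.carrier, D.rd x = g := by
  obtain ⟨x, rfl⟩ := D.proj_surjective g
  exact ⟨x.1, x.2, D.rd_coe x⟩

/-- The function `t` from tuples to `G` is definable over `A`. -/
def DefTerm (A : Set M) (t : (γ → M) → G) : Prop :=
  DefPred L A (fun w : γ ⊕ Fin D.n → M => t (w ∘ Sum.inl) = D.rd (w ∘ Sum.inr))

/-- The family `U` of subsets of `G` is definable over `A`. -/
def DefFam (A : Set M) (U : (γ → M) → Set G) : Prop :=
  DefPred L A (fun w : γ ⊕ Fin D.n → M => D.rd (w ∘ Sum.inr) ∈ U (w ∘ Sum.inl))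

/-- The subset `U` of `G` is definable over `A`. -/
def GDef (A : Set M) (U : Set G) : Prop :=
  DefPred L A (fun x : Fin D.n → M => D.rd x ∈ U)

theorem defPred_mem_carrier : DefPred L A (fun x : Fin D.n → M => x ∈ D.carrier) :=
  DefPred.mono D.carrier_definable (Set.empty_subset _)

theorem defPred_mul_aux : DefPred L A (fun p : Fin D.n ⊕ (Fin D.n ⊕ Fin D.n) → M =>
    ∃ x y z : D.carrier, D.proj x * D.proj y = D.proj z ∧ p = Sum.elim x.1 (Sum.elim y.1 z.1)) :=
  DefPred.mono D.mul_definable (Set.empty_subset _)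

section

variable [Nonempty M]

/-- Because of the default value of `rd`, a tuple outside the carrier has to be compared with `1`,
and `1` is definable as the only idempotent of `G`. -/
theorem defPred_rep : DefPred L A (fun p : Fin D.n ⊕ Fin D.n → M =>
    p ∘ Sum.inr ∈ D.carrier ∧ D.rd (p ∘ Sum.inl) = D.rd (p ∘ Sum.inr)) := by
  have hE : DefPred L A (fun p : Fin D.n ⊕ Fin D.n → M =>
      ∃ x y : D.carrier, D.proj x = D.proj y ∧ p = Sum.elim x.1 y.1) :=
    DefPred.mono D.eq_definable (Set.empty_subset _)
  have hM := (D.defPred_mul_aux (A := A)).comp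
    (γ' := Fin D.n ⊕ Fin D.n) (Sum.elim Sum.inr (Sum.elim Sum.inr Sum.inr))
  have hC := (D.defPred_mem_carrier (A := A)).comp (γ' := Fin D.n ⊕ Fin D.n) Sum.inl
  refine (hE.or (hC.not.and hM)).congr fun p => ?_
  constructor
  · rintro (⟨x, y, hxy, rfl⟩ | ⟨hx, x, y, z, hxyz, hp⟩)
    · exact ⟨y.2, by simpa [D.rd_coe] using hxy⟩
    · have h1 : p ∘ Sum.inr = x.1 := funext fun i => congrFun hp (Sum.inl i)
      have h2 : p ∘ Sum.inr = y.1 := funext fun i => congrFun hp (Sum.inr (Sum.inl i))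
      have h3 : p ∘ Sum.inr = z.1 := funext fun i => congrFun hp (Sum.inr (Sum.inr i))
      obtain rfl : x = y := Subtype.ext (h1.symm.trans h2)
      obtain rfl : x = z := Subtype.ext (h1.symm.trans h3)
      refine ⟨h1 ▸ x.2, ?_⟩
      rw [h1, D.rd_coe, mul_eq_left.1 hxyz]
      exact dif_neg hx
  · rintro ⟨hy, h⟩
    by_cases hx : p ∘ Sum.inl ∈ D.carrier
    · refine Or.inl ⟨⟨_, hx⟩, ⟨_, hy⟩, ?_, (Sum.elim_comp_inl_inr p).symm⟩
      rwa [D.rd_of_mem hx, D.rd_of_mem hy] at h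
    · refine Or.inr ⟨hx, ⟨_, hy⟩, ⟨_, hy⟩, ⟨_, hy⟩, ?_, ?_⟩
      · rw [← D.rd_of_mem hy, ← h, show D.rd (p ∘ Sum.inl) = 1 from dif_neg hx, mul_one]
      · funext i
        rcases i with i | i | i <;> rfl

theorem defPred_rd_eq : DefPred L A (fun p : Fin D.n ⊕ Fin D.n → M =>
    D.rd (p ∘ Sum.inl) = D.rd (p ∘ Sum.inr)) := by
  have h : DefPred L A (fun p : Fin D.n ⊕ Fin D.n → M => ∃ z : Fin D.n → M,
      (z ∈ D.carrier ∧ D.rd (p ∘ Sum.inl) = D.rd z) ∧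
        (z ∈ D.carrier ∧ D.rd (p ∘ Sum.inr) = D.rd z)) := by
    refine DefPred.ex (DefPred.and ?_ ?_)
    · exact (D.defPred_rep (A := A)).comp (Sum.elim (Sum.inl ∘ Sum.inl) Sum.inr)
    · exact (D.defPred_rep (A := A)).comp (Sum.elim (Sum.inl ∘ Sum.inr) Sum.inr)
  refine h.congr fun p => ⟨?_, fun h => ?_⟩
  · rintro ⟨z, ⟨-, h1⟩, -, h2⟩
    exact h1.trans h2.symm
  · obtain ⟨z, hz, h'⟩ := D.exists_rd (D.rd (p ∘ Sum.inl))
    exact ⟨z, ⟨hz, h'.symm⟩, hz, h.symm.trans h'.symm⟩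

theorem defPred_mul : DefPred L A (fun p : Fin D.n ⊕ (Fin D.n ⊕ Fin D.n) → M =>
    D.rd (p ∘ Sum.inl) * D.rd (p ∘ Sum.inr ∘ Sum.inl) = D.rd (p ∘ Sum.inr ∘ Sum.inr)) := by
  have h : DefPred L A (fun p : Fin D.n ⊕ (Fin D.n ⊕ Fin D.n) → M =>
      ∃ q : Fin D.n ⊕ (Fin D.n ⊕ Fin D.n) → M,
        ((∃ x y z : D.carrier, D.proj x * D.proj y = D.proj z ∧
          q = Sum.elim x.1 (Sum.elim y.1 z.1)) ∧ D.rd (p ∘ Sum.inl) = D.rd (q ∘ Sum.inl)) ∧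
        (D.rd (p ∘ Sum.inr ∘ Sum.inl) = D.rd (q ∘ Sum.inr ∘ Sum.inl) ∧
        D.rd (p ∘ Sum.inr ∘ Sum.inr) = D.rd (q ∘ Sum.inr ∘ Sum.inr))) := by
    refine DefPred.ex (DefPred.and (DefPred.and ?_ ?_) (DefPred.and ?_ ?_))
    · exact (D.defPred_mul_aux (A := A)).comp Sum.inr
    · exact (D.defPred_rd_eq (A := A)).comp (Sum.elim (Sum.inl ∘ Sum.inl) (Sum.inr ∘ Sum.inl))
    · exact (D.defPred_rd_eq (A := A)).comp
        (Sum.elim (Sum.inl ∘ Sum.inr ∘ Sum.inl) (Sum.inr ∘ Sum.inr ∘ Sum.inl))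
    · exact (D.defPred_rd_eq (A := A)).comp
        (Sum.elim (Sum.inl ∘ Sum.inr ∘ Sum.inr) (Sum.inr ∘ Sum.inr ∘ Sum.inr))
  refine h.congr fun p => ⟨?_, fun h => ?_⟩
  · rintro ⟨_, ⟨⟨x, y, z, h, rfl⟩, h1⟩, h2, h3⟩
    rw [h1, h2, h3]
    simpa [← Function.comp_assoc, D.rd_coe] using h
  · obtain ⟨x, hx⟩ := D.proj_surjective (D.rd (p ∘ Sum.inl))
    obtain ⟨y, hy⟩ := D.proj_surjective (D.rd (p ∘ Sum.inr ∘ Sum.inl))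
    obtain ⟨z, hz⟩ := D.proj_surjective (D.rd (p ∘ Sum.inr ∘ Sum.inr))
    refine ⟨_, ⟨⟨x, y, z, by rw [hx, hy, hz, h], rfl⟩, ?_⟩, ?_, ?_⟩
    · simp [D.rd_coe, hx]
    · simp [← Function.comp_assoc, D.rd_coe, hy]
    · simp [← Function.comp_assoc, D.rd_coe, hz]

variable {D}

theorem _root_.StableQuotient.DefPred.exG {p : (γ → M) → G → Prop}
    (h : DefPred L A (fun w : γ ⊕ Fin D.n → M => p (w ∘ Sum.inl) (D.rd (w ∘ Sum.inr)))) :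
    DefPred L A (fun z => ∃ g, p z g) := by
  refine (DefPred.ex (p := fun z w => p z (D.rd w)) h).congr fun z => ⟨?_, ?_⟩
  · rintro ⟨w, h⟩
    exact ⟨_, h⟩
  · rintro ⟨g, h⟩
    obtain ⟨w, -, rfl⟩ := D.exists_rd g
    exact ⟨w, h⟩

theorem _root_.StableQuotient.DefPred.allG {p : (γ → M) → G → Prop}
    (h : DefPred L A (fun w : γ ⊕ Fin D.n → M => p (w ∘ Sum.inl) (D.rd (w ∘ Sum.inr)))) :
    DefPred L A (fun z => ∀ g, p z g) := by
  refine (DefPred.exG (p := fun z g => ¬ p z g) h.not).not.congr fun z => ?_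
  push Not
  rfl

namespace DefTerm

variable {t t' : (γ → M) → G}

theorem comp (ht : D.DefTerm A t) (e : γ → γ') : D.DefTerm A (fun z : γ' → M => t (z ∘ e)) :=
  DefPred.comp (γ' := γ' ⊕ Fin D.n) ht (Sum.map e id)

theorem var (e : Fin D.n → γ) : D.DefTerm A (fun z : γ → M => D.rd (z ∘ e)) :=
  (D.defPred_rd_eq (A := A)).comp (Sum.map e id)

theorem eq (ht : D.DefTerm A t) (ht' : D.DefTerm A t') : DefPred L A (fun z => t z = t' z) := by
  refine (DefPred.exG (D := D) (p := fun z g => t z = g ∧ t' z = g)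
    (DefPred.and ht ht')).congr fun z => ?_
  exact ⟨fun ⟨g, h, h'⟩ => h.trans h'.symm, fun h => ⟨_, h, rfl⟩⟩

theorem mul (ht : D.DefTerm A t) (ht' : D.DefTerm A t') :
    D.DefTerm A (fun z => t z * t' z) := by
  have h : DefPred L A (fun w : γ ⊕ Fin D.n → M => ∃ q : Fin D.n ⊕ Fin D.n → M,
      (t (w ∘ Sum.inl) = D.rd (q ∘ Sum.inl) ∧ t' (w ∘ Sum.inl) = D.rd (q ∘ Sum.inr)) ∧
        D.rd (q ∘ Sum.inl) * D.rd (q ∘ Sum.inr) = D.rd (w ∘ Sum.inr)) := by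
    refine DefPred.ex (DefPred.and (DefPred.and ?_ ?_) ?_)
    · exact DefPred.comp ht (Sum.elim (Sum.inl ∘ Sum.inl) (Sum.inr ∘ Sum.inl))
    · exact DefPred.comp ht' (Sum.elim (Sum.inl ∘ Sum.inl) (Sum.inr ∘ Sum.inr))
    · exact DefPred.comp (D.defPred_mul (A := A))
        (Sum.elim (Sum.inr ∘ Sum.inl) (Sum.elim (Sum.inr ∘ Sum.inr) (Sum.inl ∘ Sum.inr)))
  refine h.congr fun w => ⟨?_, fun h => ?_⟩
  · rintro ⟨q, ⟨h1, h2⟩, h3⟩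
    exact (congrArg₂ _ h1 h2).trans h3
  · obtain ⟨x, -, hx⟩ := D.exists_rd (t (w ∘ Sum.inl))
    obtain ⟨y, -, hy⟩ := D.exists_rd (t' (w ∘ Sum.inl))
    exact ⟨Sum.elim x y, by simp [hx, hy, h]⟩

theorem one : D.DefTerm A (fun _ : γ → M => 1) := by
  have h := DefPred.comp (D.defPred_mul (A := A)) (γ' := γ ⊕ Fin D.n)
    (Sum.elim Sum.inr (Sum.elim Sum.inr Sum.inr))
  refine h.congr fun w => ?_
  refine (mul_eq_left (a := D.rd (w ∘ Sum.inr)) (b := D.rd (w ∘ Sum.inr))).trans ?_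
  exact eq_comm

theorem inv (ht : D.DefTerm A t) : D.DefTerm A (fun z => (t z)⁻¹) := by
  have h := DefTerm.eq ((ht.comp (Sum.inl : γ → γ ⊕ Fin D.n)).mul (DefTerm.var Sum.inr)) one
  refine DefPred.congr h fun w => ?_
  exact mul_eq_one_iff_inv_eq

theorem const {x : Fin D.n → M} (hx : ∀ i, x i ∈ A) : D.DefTerm A (fun _ : γ → M => D.rd x) := by
  have := ((D.defPred_rd_eq (A := A)).comp (γ' := (γ ⊕ Fin D.n) ⊕ Fin D.n)
    (Sum.elim Sum.inr (Sum.inl ∘ Sum.inr))).subst subset_rfl x hx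
  exact this

theorem constG (g : G) : D.DefTerm Set.univ (fun _ : γ → M => g) := by
  obtain ⟨x, -, rfl⟩ := D.exists_rd g
  exact const fun i => Set.mem_univ _

end DefTerm

theorem DefFam.mono {U : (γ → M) → Set G} (hU : D.DefFam A U) (hAB : A ⊆ B) : D.DefFam B U :=
  DefPred.mono hU hAB

theorem DefFam.comp {U : (γ → M) → Set G} (hU : D.DefFam A U) (e : γ → γ') :
    D.DefFam A (fun z : γ' → M => U (z ∘ e)) :=
  DefPred.comp (γ' := γ' ⊕ Fin D.n) hU (Sum.map e id)

theorem DefFam.mem {U : (γ → M) → Set G} (hU : D.DefFam A U) {t : (γ' → M) → G}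
    (ht : D.DefTerm A t) (e : γ → γ') : DefPred L A (fun z : γ' → M => t z ∈ U (z ∘ e)) := by
  refine (DefPred.exG (D := D) (p := fun z g => t z = g ∧ g ∈ U (z ∘ e))
    (DefPred.and ht (hU.comp e))).congr fun z => ?_
  exact ⟨fun ⟨g, h, h'⟩ => h ▸ h', fun h => ⟨_, rfl, h⟩⟩

theorem GDef.mono {U : Set G} (hU : D.GDef A U) (hAB : A ⊆ B) : D.GDef B U :=
  DefPred.mono hU hAB

theorem GDef.defFam {U : Set G} (hU : D.GDef A U) : D.DefFam A (fun _ : γ → M => U) :=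
  DefPred.comp hU Sum.inr

theorem GDef.mem {U : Set G} (hU : D.GDef A U) {t : (γ → M) → G} (ht : D.DefTerm A t) :
    DefPred L A (fun z : γ → M => t z ∈ U) :=
  (hU.defFam (γ := γ)).mem ht id

theorem DefFam.gdef {U : (γ → M) → Set G} (hU : D.DefFam A U) (hAB : A ⊆ B) {a : γ → M}
    (ha : ∀ i, a i ∈ B) : D.GDef B (U a) :=
  (DefPred.comp hU Sum.swap).subst hAB a ha

/-- The family of sets `{g | g V ∩ Q ≠ ∅}`. -/
theorem DefFam.translate {U V : (γ → M) → Set G} (hU : D.DefFam A U) (hV : D.DefFam A V) :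
    D.DefFam A (fun z => {g | ∃ v ∈ V z, g * v ∈ U z}) := by
  refine DefPred.exG (D := D) (p := fun (w : γ ⊕ Fin D.n → M) v =>
    v ∈ V (w ∘ Sum.inl) ∧ D.rd (w ∘ Sum.inr) * v ∈ U (w ∘ Sum.inl)) ?_
  exact (hV.mem (DefTerm.var Sum.inr) (Sum.inl ∘ Sum.inl)).and
    (hU.mem ((DefTerm.var (Sum.inl ∘ Sum.inr)).mul (DefTerm.var Sum.inr)) (Sum.inl ∘ Sum.inl))

/-- A definable family is a reindexing of a `∅`-definable family. -/
theorem DefFam.exists_encoding {P : (γ → M) → Set G} (hP : D.DefFam A P) :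
    ∃ P' : (ℕ → M) → Set G, D.DefFam ∅ P' ∧ ∃ enc : (γ → M) → ℕ → M, ∀ b, P b = P' (enc b) := by
  obtain ⟨T, p₀, hp₀, hp⟩ := DefPred.exists_support hP
  -- The finitely many parameters from `A` and index coordinates that matter are all stored in one
  -- `ℕ`-tuple; only the variables for the element of `G` are kept.
  let e : T → ℕ := fun t => T.equivFin t
  have he : Function.Injective e := fun a b h => T.equivFin.injective (Fin.ext h)
  let r : T → ℕ ⊕ Fin D.n := fun t =>
    Sum.elim (fun _ => Sum.inl (e t)) (Sum.elim (fun _ => Sum.inl (e t)) Sum.inr) t.1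
  let val : (γ → M) → T → M := fun b t =>
    Sum.elim (↑) (Sum.elim b fun _ => Classical.arbitrary M) t.1
  refine ⟨fun c => {g | ∃ x, D.rd x = g ∧ p₀ (Sum.elim c x ∘ r)}, ?_,
    fun b => Function.extend e (val b) fun _ => Classical.arbitrary M, fun b => ?_⟩
  · refine DefPred.ex (p := fun (w : ℕ ⊕ Fin D.n → M) x =>
      D.rd x = D.rd (w ∘ Sum.inr) ∧ p₀ (Sum.elim (w ∘ Sum.inl) x ∘ r)) (DefPred.and ?_ ?_)
    · exact DefTerm.eq (DefTerm.var Sum.inr) (DefTerm.var (Sum.inl ∘ Sum.inr))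
    · refine (hp₀.comp (Sum.elim (Sum.inl ∘ Sum.inl) Sum.inr ∘ r)).congr fun z => ?_
      refine iff_of_eq (congrArg p₀ ?_)
      funext t
      simp only [Function.comp_apply]
      cases r t <;> rfl
  · have key : ∀ x : Fin D.n → M, p₀ (Sum.elim (Function.extend e (val b)
        fun _ => Classical.arbitrary M) x ∘ r) ↔ D.rd x ∈ P b := fun x => by
      refine Iff.trans (iff_of_eq (congrArg p₀ ?_)) (hp (Sum.elim b x)).symm
      funext t
      obtain ⟨t, ht⟩ := t
      rcases t with a | i | j
      · exact he.extend_apply (val b) (fun _ => Classical.arbitrary M) (⟨Sum.inl a, ht⟩ : T)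
      · exact he.extend_apply (val b) (fun _ => Classical.arbitrary M) (⟨Sum.inr (Sum.inl i), ht⟩ : T)
      · rfl
    ext g
    constructor
    · intro hg
      obtain ⟨x, -, rfl⟩ := D.exists_rd g
      exact ⟨x, rfl, (key x).2 hg⟩
    · rintro ⟨x, rfl, hx⟩
      exact (key x).1 hx

theorem GDef.exists_family {U : Set G} (hU : D.GDef A U) :
    ∃ U' : (ℕ → M) → Set G, D.DefFam ∅ U' ∧ ∃ a, U = U' a := by
  obtain ⟨U', hU', enc, h⟩ := (hU.defFam (γ := Empty)).exists_encoding
  exact ⟨U', hU', enc Empty.elim, h _⟩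

variable (D) in
/-- A subset of `G` is type-definable over `A` if and only if it is an intersection of subsets
of `G` definable over `A`. -/
theorem typeDefinable_iff {S : Set G} :
    D.TypeDefinable A S ↔ ∃ 𝒱 : Set (Set G), (∀ V ∈ 𝒱, D.GDef A V) ∧ S = ⋂₀ 𝒱 := by
  constructor
  · rintro ⟨𝒟, h𝒟, hS⟩
    -- A set `X` need not be a union of classes, so take the elements of `G` all of whose
    -- representatives lie in `X`; the intersection is unaffected.
    refine ⟨(fun X : Set (Fin D.n → M) => {g | ∀ x : D.carrier, D.proj x = g → x.1 ∈ X}) '' 𝒟,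
      ?_, ?_⟩
    · rintro _ ⟨X, hX, rfl⟩
      have hX' : DefPred L A (fun x => x ∈ X) := h𝒟 X hX
      refine (DefPred.all (p := fun (z : Fin D.n → M) x =>
        x ∈ D.carrier → D.rd x = D.rd z → x ∈ X) ?_).congr fun z => ?_
      · exact ((D.defPred_mem_carrier).comp Sum.inr).imp
          ((DefTerm.eq (DefTerm.var Sum.inr) (DefTerm.var Sum.inl)).imp (hX'.comp Sum.inr))
      · constructor
        · exact fun h x hx => h x.1 x.2 ((D.rd_coe x).trans hx)
        · exact fun h x hx hxz => h ⟨x, hx⟩ ((D.rd_of_mem hx).symm.trans hxz)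
    · ext g
      simp only [Set.mem_sInter, Set.forall_mem_image, Set.mem_ofPred_eq]
      constructor
      · rintro hg X hX x rfl
        have : x.1 ∈ ⋂₀ 𝒟 := hS ▸ ⟨x, hg, rfl⟩
        exact this X hX
      · intro h
        obtain ⟨x, rfl⟩ := D.proj_surjective g
        have : x.1 ∈ ⋂₀ 𝒟 := fun X hX => h hX x rfl
        rw [← hS] at this
        obtain ⟨y, hy, hxy⟩ := this
        exact Subtype.ext hxy ▸ hy
  · rintro ⟨𝒱, h𝒱, rfl⟩
    refine ⟨insert D.carrier ((fun V => {x | x ∈ D.carrier ∧ D.rd x ∈ V}) '' 𝒱), ?_, ?_⟩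
    · rintro _ (rfl | ⟨V, hV, rfl⟩)
      · exact D.defPred_mem_carrier
      · exact D.defPred_mem_carrier.and (h𝒱 V hV)
    · ext x
      rw [Set.sInter_insert]
      constructor
      · rintro ⟨x, hx, rfl⟩
        refine ⟨x.2, ?_⟩
        rintro _ ⟨V, hV, rfl⟩
        exact ⟨x.2, by rw [D.rd_coe]; exact hx V hV⟩
      · rintro ⟨hx, h⟩
        refine ⟨⟨x, hx⟩, fun V hV => ?_, rfl⟩
        rw [← D.rd_of_mem hx]
        exact (h _ ⟨V, hV, rfl⟩).2

end

end DefinableGroup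

/-! ### Order patterns, local stability and the shift -/

/-- The family `P` of subsets of a group contains an order pattern of length `N`, up to right
translation by `U`. -/
def HasOrder {G : Type*} [Group G] {Y : Type*} (P : Y → Set G) (U : Set G) (N : ℕ) : Prop :=
  ∃ (g : ℕ → G) (b : ℕ → Y), ∀ i, i < N → ∀ j, j < N →
    (j < i → g i ∈ P (b j)) ∧ (i < j → ¬ ∃ u ∈ U, g i * u ∈ P (b j))

theorem HasOrder.mono {G : Type*} [Group G] {Y : Type*} {P : Y → Set G} {U V : Set G} {N : ℕ}
    (h : HasOrder P U N) (hVU : V ⊆ U) : HasOrder P V N := by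
  obtain ⟨g, b, h⟩ := h
  exact ⟨g, b, fun i hi j hj => ⟨(h i hi j hj).1, fun hij ⟨u, hu, hu'⟩ =>
    (h i hi j hj).2 hij ⟨u, hVU hu, hu'⟩⟩⟩

theorem HasOrder.map {G : Type*} [Group G] {Y Y' : Type*} {P : Y → Set G} {P' : Y' → Set G}
    {e : Y → Y'} (he : ∀ y, P y = P' (e y)) {U : Set G} {N : ℕ}
    (h : HasOrder P U N) : HasOrder P' U N := by
  obtain ⟨g, b, h⟩ := h
  refine ⟨g, fun i => e (b i), fun i hi j hj => ?_⟩
  rw [← he]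
  exact h i hi j hj

namespace DefinableGroup

variable {L : FirstOrder.Language.{u, v}} {M : Type w} [L.Structure M] [Nonempty M]
  {G : Type w'} [Group G] (D : DefinableGroup L M G) {A B : Set M} {γ : Type*} {γ' : Type*}

/-- A local form of stability of the space of left cosets of `H`: no definable family of subsets
of `G` has arbitrarily long order patterns up to a definable neighbourhood of `H`. -/
def StableSub (H : Subgroup G) : Prop :=
  ∀ P : (ℕ → M) → Set G, D.DefFam ∅ P → ∀ U : Set G, D.GDef Set.univ U → (H : Set G) ⊆ U →
    ∃ N, ¬ HasOrder P U N

/-- The subgroup `H` is type-definable over a small set, with a stable space of left cosets. -/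
def Good (κ : Cardinal.{w}) (H : Subgroup G) : Prop :=
  (∃ A : Set M, #A < κ ∧ D.TypeDefinable A (H : Set G)) ∧ D.StableSub H

variable {D}

theorem DefFam.compl {U : (γ → M) → Set G} (hU : D.DefFam A U) :
    D.DefFam A (fun z => (U z)ᶜ) :=
  DefPred.not hU

theorem GDef.finset_inter {ι : Type*} {F : ι → Set G} (hF : ∀ i, D.GDef A (F i))
    (s : Finset ι) : D.GDef A {g | ∀ i ∈ s, g ∈ F i} :=
  (DefPred.finite_all (p := fun (i : s) x => D.rd x ∈ F i) fun i => hF i).congr fun _ =>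
    ⟨fun H i hi => H ⟨i, hi⟩, fun H i => H i.1 i.2⟩

/-- Parameters and arbitrary index tuples can be encoded in `ℕ`-tuples, so nothing is lost by
testing `StableSub` on `∅`-definable families only. -/
theorem StableSub.not_hasOrder {H : Subgroup G} (hH : D.StableSub H) {P : (γ → M) → Set G}
    (hP : D.DefFam A P) {U : Set G} (hU : D.GDef Set.univ U) (hHU : (H : Set G) ⊆ U) :
    ∃ N, ¬ HasOrder P U N := by
  obtain ⟨P', hP', enc, henc⟩ := hP.exists_encoding
  obtain ⟨N, hN⟩ := hH P' hP' U hU hHU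
  exact ⟨N, fun h => hN (h.map henc)⟩

/-- `StableSub` involves one neighbourhood `U` at a time. This handles infinite intersections, where
compactness puts a finite subintersection inside `U`. -/
theorem StableSub.of_forall {H : Subgroup G} (h : ∀ U : Set G, D.GDef Set.univ U → (H : Set G) ⊆ U →
    ∃ K : Subgroup G, D.StableSub K ∧ (K : Set G) ⊆ U) : D.StableSub H := fun P hP U hU hHU => by
  obtain ⟨K, hK, hKU⟩ := h U hU hHU
  exact hK P hP U hU hKU

/-- For fixed `N` an order pattern is a first-order condition on the parameter of `U`; hence
stability passes between parameters of the same type. -/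
theorem defPred_hasOrder {P : (γ → M) → Set G} (hP : D.DefFam A P) {U : (γ' → M) → Set G}
    (hU : D.DefFam A U) (N : ℕ) : DefPred L A (fun c => HasOrder P (U c) N) := by
  have h : DefPred L A (fun c : γ' → M => ∃ z : (ℕ × Fin D.n) ⊕ (ℕ × γ) → M,
      ∀ i, i < N → ∀ j, j < N →
      (j < i → D.rd (z ∘ Sum.inl ∘ Prod.mk i) ∈ P (z ∘ Sum.inr ∘ Prod.mk j)) ∧
      (i < j → D.rd (z ∘ Sum.inl ∘ Prod.mk i) ∉
        {g | ∃ u ∈ U c, g * u ∈ P (z ∘ Sum.inr ∘ Prod.mk j)})) := by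
    refine DefPred.ex (DefPred.all_of_imp_fin (fun i hi => hi) fun i =>
      DefPred.all_of_imp_fin (fun i hi => hi) fun j =>
      ((DefPred.const _).imp ?_).and ((DefPred.const _).imp (DefPred.not ?_)))
    · exact hP.mem (DefTerm.var (Sum.inr ∘ Sum.inl ∘ Prod.mk i)) (Sum.inr ∘ Sum.inr ∘ Prod.mk j)
    · exact ((hP.comp Sum.inr).translate (hU.comp (Sum.inl : γ' → γ' ⊕ γ))).mem
        (DefTerm.var (Sum.inr ∘ Sum.inl ∘ Prod.mk i))
        (Sum.elim Sum.inl (Sum.inr ∘ Sum.inr ∘ Prod.mk j))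
  refine h.congr fun c => ⟨?_, ?_⟩
  · rintro ⟨z, hz⟩
    exact ⟨fun i => D.rd (z ∘ Sum.inl ∘ Prod.mk i), fun j => z ∘ Sum.inr ∘ Prod.mk j, hz⟩
  · rintro ⟨g, b, hgb⟩
    choose x _ hx using fun i => D.exists_rd (g i)
    refine ⟨Sum.elim (fun q => x q.1 q.2) (fun q => b q.1 q.2), fun i hi j hj => ?_⟩
    have h1 : D.rd (Sum.elim (fun q : ℕ × Fin D.n => x q.1 q.2) (fun q : ℕ × γ => b q.1 q.2) ∘
      Sum.inl ∘ Prod.mk i) = g i := hx i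
    rw [h1]
    exact hgb i hi j hj

section Saturated

variable {κ : Cardinal.{w}}

theorem exists_finset (hM : IsSaturated L M κ) (hκ : ℵ₀ < κ) (hA : #A < κ) {ι : Type*}
    {F : ι → Set G} (hF : ∀ i, D.GDef A (F i)) {U : Set G} (hU : D.GDef Set.univ U)
    (h : ⋂ i, F i ⊆ U) : ∃ s : Finset ι, {g | ∀ i ∈ s, g ∈ F i} ⊆ U := by
  obtain ⟨s, hs⟩ := hM.exists_finset hκ (lift_mk_lt_of_countable hκ _) hA hF hU
    (fun z hz => h (Set.mem_iInter.2 hz))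
  refine ⟨s, fun g hg => ?_⟩
  obtain ⟨x, -, rfl⟩ := D.exists_rd g
  exact hs x hg

theorem exists_seq_of_forall_hasOrder (hM : IsSaturated L M κ) (hκ : ℵ₀ < κ) [Countable γ]
    {P : (γ → M) → Set G} (hP : D.DefFam A P) {U : Set G} (hU : D.GDef Set.univ U)
    (h : ∀ N, HasOrder P U N) : ∃ (g : ℕ → G) (b : ℕ → γ → M), ∀ i j,
      (j < i → g i ∈ P (b j)) ∧ (i < j → ¬ ∃ u ∈ U, g i * u ∈ P (b j)) := by
  obtain ⟨B₁, -, hB₁, hP₁⟩ := DefPred.exists_countable hP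
  obtain ⟨B₂, -, hB₂, hU₂⟩ := DefPred.exists_countable hU
  replace hP₁ : D.DefFam (B₁ ∪ B₂) P := DefPred.mono hP₁ Set.subset_union_left
  replace hU₂ : D.GDef (B₁ ∪ B₂) U := DefPred.mono hU₂ Set.subset_union_right
  obtain ⟨z, hz⟩ := hM.compactness_countable hκ (mk_lt_of_countable hκ (hB₁.union hB₂))
    (γ := (ℕ × Fin D.n) ⊕ (ℕ × γ)) (ι := ℕ × ℕ) (fun q z =>
      (q.2 < q.1 → D.rd (z ∘ Sum.inl ∘ Prod.mk q.1) ∈ P (z ∘ Sum.inr ∘ Prod.mk q.2)) ∧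
      (q.1 < q.2 → D.rd (z ∘ Sum.inl ∘ Prod.mk q.1) ∉
        {g | ∃ u ∈ U, g * u ∈ P (z ∘ Sum.inr ∘ Prod.mk q.2)})) (fun q => by
      refine ((DefPred.const _).imp ?_).and ((DefPred.const _).imp (DefPred.not ?_))
      · exact hP₁.mem (DefTerm.var (Sum.inl ∘ Prod.mk q.1)) (Sum.inr ∘ Prod.mk q.2)
      · exact (hP₁.translate hU₂.defFam).mem (DefTerm.var (Sum.inl ∘ Prod.mk q.1))
          (Sum.inr ∘ Prod.mk q.2)) (fun s => by
      obtain ⟨g, b, hgb⟩ := h (s.sup (fun q => q.1 + q.2) + 1)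
      choose x _ hx using fun i => D.exists_rd (g i)
      refine ⟨Sum.elim (fun q => x q.1 q.2) (fun q => b q.1 q.2), fun q hq => ?_⟩
      have h1 : ∀ i, D.rd (Sum.elim (fun q : ℕ × Fin D.n => x q.1 q.2)
        (fun q : ℕ × γ => b q.1 q.2) ∘ Sum.inl ∘ Prod.mk i) = g i := hx
      have h2 : q.1 + q.2 ≤ s.sup (fun q => q.1 + q.2) :=
        Finset.le_sup (f := fun q : ℕ × ℕ => q.1 + q.2) hq
      rw [h1]
      exact hgb q.1 (by omega) q.2 (by omega))
  exact ⟨fun i => D.rd (z ∘ Sum.inl ∘ Prod.mk i), fun j => z ∘ Sum.inr ∘ Prod.mk j,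
    fun i j => hz (i, j)⟩

/-- Every definable neighbourhood `V` of a type-definable subgroup contains `W * W` for some
symmetric definable neighbourhood `W`. -/
theorem exists_mul_subset (hM : IsSaturated L M κ) (hκ : ℵ₀ < κ) (hA : #A < κ) {H : Subgroup G}
    (hH : D.TypeDefinable A (H : Set G)) {V : Set G} (hV : D.GDef Set.univ V)
    (hHV : (H : Set G) ⊆ V) :
    ∃ W, D.GDef A W ∧ (H : Set G) ⊆ W ∧ (∀ x ∈ W, x⁻¹ ∈ W) ∧ ∀ x ∈ W, ∀ y ∈ W, x * y ∈ V := by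
  obtain ⟨𝒱, h𝒱, hH⟩ := typeDefinable_iff D |>.1 hH
  have hH' : ∀ g, g ∈ H ↔ ∀ i : 𝒱, g ∈ i.1 := fun g => by
    rw [← SetLike.mem_coe, hH, Set.mem_sInter]
    exact ⟨fun h i => h _ i.2, fun h i hi => h ⟨i, hi⟩⟩
  obtain ⟨s, hs⟩ := hM.exists_finset hκ
    (γ := Fin D.n ⊕ Fin D.n) (lift_mk_lt_of_countable hκ _) hA (ι := 𝒱)
    (p := fun i z => D.rd (z ∘ Sum.inl) ∈ i.1 ∧ D.rd (z ∘ Sum.inr) ∈ i.1)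
    (fun i => ((h𝒱 _ i.2).mem (DefTerm.var _)).and ((h𝒱 _ i.2).mem (DefTerm.var _)))
    (q := fun z => D.rd (z ∘ Sum.inl) * D.rd (z ∘ Sum.inr) ∈ V)
    (hV.mem ((DefTerm.var _).mul (DefTerm.var _)))
    (fun z hz => hHV (H.mul_mem ((hH' _).2 fun i => (hz i).1) ((hH' _).2 fun i => (hz i).2)))
  refine ⟨{g | ∀ i ∈ s, g ∈ {x | x ∈ i.1 ∧ x⁻¹ ∈ i.1}}, GDef.finset_inter (fun i => ?_) s,
    fun g hg i _ => ⟨(hH' _).1 hg i, (hH' _).1 (H.inv_mem hg) i⟩,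
    fun x hx i hi => ⟨(hx i hi).2, by rw [inv_inv]; exact (hx i hi).1⟩, fun x hx y hy => ?_⟩
  · exact ((h𝒱 _ i.2).mem (DefTerm.var id)).and ((h𝒱 _ i.2).mem (DefTerm.var id).inv)
  · obtain ⟨x, -, rfl⟩ := D.exists_rd x
    obtain ⟨y, -, rfl⟩ := D.exists_rd y
    exact hs (Sum.elim x y) fun i hi => ⟨(hx i hi).1, (hy i hi).1⟩

/-- Moving one point of a configuration to an earlier position, within its class modulo a stable
subgroup. -/
theorem Good.exists_shift (hM : IsSaturated L M κ) (hκ : ℵ₀ < κ) {H : Subgroup G}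
    (hH : D.Good κ H) {d : ℕ} {Q : (Fin d → γ → M) → Set G}
    (hQ : D.DefFam A (fun z : Fin d × γ → M => Q (fun q => z ∘ Prod.mk q)))
    (g : ℕ → G) (b : ℕ → γ → M) (p : Fin (d + 1))
    (h0 : ∀ s : Fin (d + 1) → ℕ, StrictMono s → g (s p) ∈ Q (fun q => b (s (p.succAbove q))))
    (k : ℕ) : ∀ (p' : Fin (d + 1)), p'.val + k = p.val → ∀ V : Set G, D.GDef Set.univ V →
      (H : Set G) ⊆ V → ∀ f₀ : ℕ → ℕ, StrictMono f₀ → ∃ f : ℕ → ℕ, StrictMono f ∧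
        ∀ s : Fin (d + 1) → ℕ, StrictMono s → ∃ v ∈ V, g (f₀ (f (s p'))) * v ∈
          Q (fun q => b (f₀ (f (s (p'.succAbove q))))) := by
  induction k with
  | zero =>
    intro p' hp' V hV hHV f₀ hf₀
    obtain rfl : p' = p := Fin.ext hp'
    refine ⟨id, strictMono_id, fun s hs => ⟨1, hHV H.one_mem, ?_⟩⟩
    rw [mul_one]
    exact h0 (f₀ ∘ s) (hf₀.comp hs)
  | succ k ih =>
    intro p' hp' V hV hHV f₀ hf₀
    obtain ⟨⟨A', hA', hHA⟩, hHs⟩ := hH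
    obtain ⟨W, hW, hHW, -, hWV⟩ := exists_mul_subset hM hκ hA' hHA hV hHV
    replace hW : D.GDef Set.univ W := hW.mono (Set.subset_univ _)
    have hr : p'.val < d := by omega
    obtain ⟨r, rfl⟩ : ∃ r : Fin d, p' = r.castSucc := ⟨⟨p'.val, hr⟩, rfl⟩
    obtain ⟨f₁, hf₁, h₁⟩ := ih r.succ (by simp at hp' ⊢; omega) W hW hHW f₀ hf₀
    -- By induction the relation holds at place `r + 1` up to `W`. By Ramsey, at place `r` it holds
    -- up to `V` either always, as wanted, or never.
    obtain ⟨f₂, hf₂, h₂ | h₂⟩ := ramsey (d + 1) (fun s => ∃ v ∈ V,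
      g (f₀ (f₁ (s r.castSucc))) * v ∈ Q (fun q => b (f₀ (f₁ (s (r.castSucc.succAbove q))))))
    · exact ⟨f₁ ∘ f₂, hf₁.comp hf₂, h₂⟩
    · exfalso
      obtain ⟨N, hN⟩ := hHs.not_hasOrder ((hQ.mono (Set.subset_univ _)).translate hW.defFam) hW hHW
      -- Keep the `b` at places below `r` and beyond `r + N` fixed, and let `g` and one `b` run
      -- through the window of length `N` starting at `r`. With `g` after that `b`, the relation
      -- holds up to `W`; with `g` before it, it fails up to `V ⊇ W * W`. This is an order pattern
      -- of length `N` for the `W`-translate of `Q`. `S lo hi` lists all the indices used, `pos`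
      -- those of the `b`.
      let pos : ℕ → Fin d → ℕ := fun x q => 
        if q.val < r.val then q.val else if q.val = r.val then r.val + x else N + q.val
      let S : ℕ → ℕ → Fin (d + 1) → ℕ := fun lo hi i =>
        if i.val < r.val then i.val else if i.val = r.val then r.val + lo
          else if i.val = r.val + 1 then r.val + hi else N + i.val - 1
      have hval : ∀ (p : Fin (d + 1)) (q : Fin d),
          (p.succAbove q).val = if q.val < p.val then q.val else q.val + 1 := fun p q => by
        rw [Fin.succAbove]
        split_ifs with h h' h' <;> simp_all [Fin.lt_def]
      have hS : ∀ lo hi, lo < hi → hi < N → StrictMono (S lo hi) := by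
        intro lo hi h h' i j hij
        have : i.val < j.val := hij
        simp only [S]
        split_ifs <;> omega
      have hSr : ∀ lo hi, S lo hi r.succ = r + hi := fun lo hi => by simp [S]
      have hSc : ∀ lo hi, S lo hi r.castSucc = r + lo := fun lo hi => by simp [S]
      have hSr' : ∀ lo hi q, S lo hi (r.succ.succAbove q) = pos lo q := fun lo hi q => by
        simp only [S, pos, hval, Fin.val_succ]
        split_ifs <;> omega
      have hSc' : ∀ lo hi q, S lo hi (r.castSucc.succAbove q) = pos hi q := fun lo hi q => by
        simp only [S, pos, hval, Fin.val_castSucc]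
        split_ifs <;> omega
      refine hN ⟨fun a => g (f₀ (f₁ (f₂ (r + a)))),
        fun a x => b (f₀ (f₁ (f₂ (pos a x.1)))) x.2, fun i hi j hj => ⟨fun hji => ?_,
          fun hij => ?_⟩⟩
      · have := h₁ (f₂ ∘ S j i) (hf₂.comp (hS _ _ hji hi))
        simp only [Function.comp_apply, hSr, hSr'] at this
        exact this
      · rintro ⟨u, hu, v, hv, huv⟩
        refine h₂ (S i j) (hS _ _ hij hj) ⟨u * v, hWV u hu v hv, ?_⟩
        simp only [Function.comp_apply, hSc, hSc']
        rw [mul_assoc] at huv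
        exact huv

theorem Good.exists_strictMono_shift (hM : IsSaturated L M κ) (hκ : ℵ₀ < κ) {H : Subgroup G}
    (hH : D.Good κ H) {d : ℕ} {Q : (Fin d → γ → M) → Set G}
    (hQ : D.DefFam A (fun z : Fin d × γ → M => Q (fun q => z ∘ Prod.mk q)))
    {V : Set G} (hV : D.GDef Set.univ V) (hHV : (H : Set G) ⊆ V)
    (g : ℕ → G) (b : ℕ → γ → M) (p : Fin (d + 1))
    (h0 : ∀ s : Fin (d + 1) → ℕ, StrictMono s → g (s p) ∈ Q (fun q => b (s (p.succAbove q)))) :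
    ∃ f : ℕ → ℕ, StrictMono f ∧ ∀ p' ≤ p, ∀ s : Fin (d + 1) → ℕ, StrictMono s →
      ∃ v ∈ V, g (f (s p')) * v ∈ Q (fun q => b (f (s (p'.succAbove q)))) := by
  obtain ⟨f, hf, h⟩ := exists_strictMono_forall_finset (Finset.Iic p) (fun p' f =>
    ∀ s : Fin (d + 1) → ℕ, StrictMono s →
      ∃ v ∈ V, g (f (s p')) * v ∈ Q (fun q => b (f (s (p'.succAbove q)))))
    (fun p' _ f f' hf' h s hs => h (f' ∘ s) (hf'.comp hs))
    (fun p' hp' f hf => hH.exists_shift hM hκ hQ g b p h0 (p.val - p'.val) p' (by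
      have : p' ≤ p := Finset.mem_Iic.1 hp'
      have : p'.val ≤ p.val := this
      omega) V hV hHV f hf)
  exact ⟨f, hf, fun p' hp' => h p' (Finset.mem_Iic.2 hp')⟩

end Saturated

end DefinableGroup

/-! ### Intersections and conjugates of good subgroups -/

namespace DefinableGroup

variable {L : FirstOrder.Language.{u, v}} {M : Type w} [L.Structure M] [Nonempty M]
  {G : Type w'} [Group G] {D : DefinableGroup L M G} {A B : Set M} {γ : Type*} {γ' : Type*}
  {κ : Cardinal.{w}}

theorem typeDefinable_iInf {ι : Type*} {K : ι → Subgroup G}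
    (h : ∀ i, D.TypeDefinable A (K i : Set G)) :
    D.TypeDefinable A ((⨅ i, K i : Subgroup G) : Set G) := by
  choose 𝒱 h𝒱 hK using fun i => (typeDefinable_iff D).1 (h i)
  refine (typeDefinable_iff D).2 ⟨⋃ i, 𝒱 i, fun V hV => ?_, ?_⟩
  · obtain ⟨i, hi⟩ := Set.mem_iUnion.1 hV
    exact h𝒱 i V hi
  · rw [Set.sInter_iUnion, Subgroup.coe_iInf]
    exact Set.iInter_congr hK

theorem typeDefinable_inf {H₁ H₂ : Subgroup G} (h₁ : D.TypeDefinable A (H₁ : Set G))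
    (h₂ : D.TypeDefinable A (H₂ : Set G)) : D.TypeDefinable A ((H₁ ⊓ H₂ : Subgroup G) : Set G) := by
  rw [inf_eq_iInf]
  exact typeDefinable_iInf (by rintro (_ | _) <;> assumption)

theorem typeDefinable_mono {S : Set G} (h : D.TypeDefinable A S) (hAB : A ⊆ B) :
    D.TypeDefinable B S := by
  obtain ⟨𝒟, h𝒟, hS⟩ := h
  exact ⟨𝒟, fun X hX => (h𝒟 X hX).mono hAB, hS⟩

/-- A definable neighbourhood of `H₁ ⊓ H₂` contains the intersection of neighbourhoods of `H₁`
and `H₂`. -/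
theorem exists_inter_subset (hM : IsSaturated L M κ) (hκ : ℵ₀ < κ) (hA : #A < κ) (hB : #B < κ)
    {H₁ H₂ : Subgroup G} (h₁ : D.TypeDefinable A (H₁ : Set G))
    (h₂ : D.TypeDefinable B (H₂ : Set G)) {U : Set G} (hU : D.GDef Set.univ U)
    (hHU : ((H₁ ⊓ H₂ : Subgroup G) : Set G) ⊆ U) :
    ∃ U₁ U₂ : Set G, D.GDef Set.univ U₁ ∧ D.GDef Set.univ U₂ ∧ (H₁ : Set G) ⊆ U₁ ∧
      (H₂ : Set G) ⊆ U₂ ∧ U₁ ∩ U₂ ⊆ U := by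
  obtain ⟨𝒱₁, h𝒱₁, hH₁⟩ := (typeDefinable_iff D).1 h₁
  obtain ⟨𝒱₂, h𝒱₂, hH₂⟩ := (typeDefinable_iff D).1 h₂
  obtain ⟨s, hs⟩ := exists_finset hM hκ (mk_union_lt hκ.le hA hB) (ι := 𝒱₁ ⊕ 𝒱₂)
    (F := Sum.elim (↑) (↑)) (by
      rintro (i | i)
      · exact (h𝒱₁ _ i.2).mono Set.subset_union_left
      · exact (h𝒱₂ _ i.2).mono Set.subset_union_right) hU (by
      intro g hg
      refine hHU (Subgroup.mem_inf.2 ⟨?_, ?_⟩)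
      · rw [← SetLike.mem_coe, hH₁]
        exact fun V hV => Set.mem_iInter.1 hg (Sum.inl ⟨V, hV⟩)
      · rw [← SetLike.mem_coe, hH₂]
        exact fun V hV => Set.mem_iInter.1 hg (Sum.inr ⟨V, hV⟩))
  refine ⟨{g | ∀ i ∈ s.toLeft, g ∈ i.1}, {g | ∀ i ∈ s.toRight, g ∈ i.1},
    GDef.finset_inter (fun i => (h𝒱₁ _ i.2).mono (Set.subset_univ _)) _,
    GDef.finset_inter (fun i => (h𝒱₂ _ i.2).mono (Set.subset_univ _)) _, ?_, ?_, ?_⟩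
  · rw [hH₁]
    exact fun g hg i _ => hg _ i.2
  · rw [hH₂]
    exact fun g hg i _ => hg _ i.2
  · rintro g ⟨hg₁, hg₂⟩
    refine hs fun i hi => ?_
    rcases i with i | i
    · exact hg₁ i (Finset.mem_toLeft.2 hi)
    · exact hg₂ i (Finset.mem_toRight.2 hi)

/-- Stability of `H₁` allows all the `g i` of a pattern to be moved into a single translate of a
small neighbourhood `V` of `H₁`. Inside that translate only multipliers from `V⁻¹ * V ⊆ U₁` matter,
so the pattern up to `U ⊇ U₁ ∩ U₂` becomes a pattern up to `U₂`, against stability of `H₂`. -/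
theorem Good.inf (hM : IsSaturated L M κ) (hκ : ℵ₀ < κ) {H₁ H₂ : Subgroup G}
    (h₁ : D.Good κ H₁) (h₂ : D.Good κ H₂) : D.Good κ (H₁ ⊓ H₂) := by
  obtain ⟨A₁, hA₁, hHA₁⟩ := h₁.1
  obtain ⟨A₂, hA₂, hHA₂⟩ := h₂.1
  refine ⟨⟨A₁ ∪ A₂, mk_union_lt hκ.le hA₁ hA₂, typeDefinable_inf
    (typeDefinable_mono hHA₁ Set.subset_union_left)
    (typeDefinable_mono hHA₂ Set.subset_union_right)⟩, fun P hP U hU hHU => ?_⟩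
  by_contra! hall
  obtain ⟨U₁, U₂, hU₁, hU₂, hHU₁, hHU₂, hUU⟩ := exists_inter_subset hM hκ hA₁ hA₂ hHA₁ hHA₂ hU hHU
  obtain ⟨g, b, hgb⟩ := exists_seq_of_forall_hasOrder hM hκ hP hU hall
  obtain ⟨V, hV, hHV, hVinv, hVV⟩ := exists_mul_subset hM hκ hA₁ hHA₁ hU₁ hHU₁
  replace hV : D.GDef Set.univ V := hV.mono (Set.subset_univ _)
  replace hP : D.DefFam Set.univ P := hP.mono (Set.empty_subset _)
  let P' : (ℕ ⊕ Fin D.n → M) → Set G := fun z =>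
    {x | x ∈ P (z ∘ Sum.inl) ∧ (D.rd (z ∘ Sum.inr))⁻¹ * x ∈ V}
  have hP' : D.DefFam Set.univ P' :=
    (hP.mem (DefTerm.var Sum.inr) (Sum.inl ∘ Sum.inl)).and
      (hV.mem ((DefTerm.var (Sum.inl ∘ Sum.inr)).inv.mul (DefTerm.var Sum.inr)))
  obtain ⟨N, hN⟩ := h₂.2.not_hasOrder hP' hU₂ hHU₂
  -- `Q p` expresses that `x` sits at the cut `p` among `N` parameters. The term `g (s p)` satisfies
  -- it, and the shift carries it to place `0`, which is the same place for every `p`.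
  let Q : Fin (N + 1) → (Fin N → ℕ → M) → Set G := fun p y => {x | ∀ q : Fin N,
    (q.val < p.val → x ∈ P (y q)) ∧ (p.val ≤ q.val → x ∉ {x | ∃ u ∈ U, x * u ∈ P (y q)})}
  have hQ : ∀ p, D.DefFam Set.univ (fun z : Fin N × ℕ → M => Q p (fun q => z ∘ Prod.mk q)) :=
    fun p => DefPred.finite_all fun q =>
      ((DefPred.const _).imp (hP.mem (DefTerm.var Sum.inr) (Sum.inl ∘ Prod.mk q))).and
      ((DefPred.const _).imp (DefPred.not
        ((hP.translate hU.defFam).mem (DefTerm.var Sum.inr) (Sum.inl ∘ Prod.mk q))))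
  obtain ⟨f, hf, hfQ⟩ := exists_strictMono_forall_finset Finset.univ
    (fun (p : Fin (N + 1)) f => ∀ s : Fin (N + 1) → ℕ, StrictMono s →
      ∃ v ∈ V, g (f (s 0)) * v ∈ Q p (fun q => b (f (s q.succ))))
    (fun p _ f f' hf' h s hs => h (f' ∘ s) (hf'.comp hs))
    (fun p _ f hf => by
      obtain ⟨f', hf', h⟩ := h₁.exists_strictMono_shift hM hκ (hQ p) hV hHV
        (g ∘ f) (b ∘ f) p (fun s hs q => by
          refine ⟨fun hq => ?_, fun hq => ?_⟩
          · change g (f (s p)) ∈ P (b (f (s (p.succAbove q))))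
            rw [Fin.succAbove_of_castSucc_lt _ _ hq]
            exact (hgb _ _).1 (hf (hs hq))
          · change ¬ ∃ u ∈ U, g (f (s p)) * u ∈ P (b (f (s (p.succAbove q))))
            rw [Fin.succAbove_of_le_castSucc _ _ hq]
            exact (hgb _ _).2 (hf (hs (Fin.le_castSucc_iff.1 hq))))
      exact ⟨f', hf', fun s hs => h 0 (Fin.zero_le _) s hs⟩)
  have hval : StrictMono (Fin.val : Fin (N + 1) → ℕ) := fun _ _ h => h
  choose v hvV hv using fun p => hfQ p (Finset.mem_univ _) Fin.val hval
  obtain ⟨x, -, hx⟩ := D.exists_rd (g (f 0))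
  refine hN ⟨fun i => if h : i < N + 1 then g (f 0) * v ⟨i, h⟩ else 1,
    fun j => Sum.elim (b (f (j + 1))) x, fun i hi j hj => ?_⟩
  have hi' : i < N + 1 := by omega
  simp only [dif_pos hi']
  have h := hv ⟨i, hi'⟩ ⟨j, hj⟩
  refine ⟨fun hij => ⟨h.1 hij, ?_⟩, ?_⟩
  · rw [Sum.elim_comp_inr, hx, inv_mul_cancel_left]
    exact hvV _
  · rintro hij ⟨u, hu, huP, huV⟩
    rw [Sum.elim_comp_inr, hx, mul_assoc, inv_mul_cancel_left] at huV
    refine h.2 hij.le ⟨u, hUU ⟨?_, hu⟩, huP⟩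
    have := hVV _ (hVinv _ (hvV ⟨i, hi'⟩)) _ huV
    rwa [inv_mul_cancel_left] at this

theorem good_top (hκ : ℵ₀ < κ) : D.Good κ (⊤ : Subgroup G) := by
  refine ⟨⟨∅, mk_lt_of_countable hκ Set.countable_empty,
    (typeDefinable_iff D).2 ⟨∅, by simp, by simp⟩⟩, fun P _ U _ hU => ⟨3, ?_⟩⟩
  rintro ⟨g, b, h⟩
  -- With `U = G` any two elements are translates of each other, so `g 2 ∈ P (b 1)` contradicts the
  -- requirement on `g 0`.
  refine (h 0 (by omega) 1 (by omega)).2 (by omega) ⟨(g 0)⁻¹ * g 2, hU (Set.mem_univ _), ?_⟩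
  rw [mul_inv_cancel_left]
  exact (h 2 (by omega) 1 (by omega)).1 (by omega)

theorem Good.finset_inf (hM : IsSaturated L M κ) (hκ : ℵ₀ < κ) {ι : Type*} {K : ι → Subgroup G}
    (h : ∀ i, D.Good κ (K i)) (s : Finset ι) : D.Good κ (⨅ i ∈ s, K i) := by
  rw [← Finset.inf_eq_iInf]
  refine Finset.inf_induction (p := D.Good κ) (good_top hκ)
    (fun _ h₁ _ h₂ => Good.inf hM hκ h₁ h₂) fun i _ => h i

/-- Right multiplication by `g` turns a pattern for `P` up to `U` into one for `P * g` up to `g⁻¹ *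
U * g`. -/
theorem Good.conj (hκ : ℵ₀ < κ) {H : Subgroup G} (h : D.Good κ H) (g : G) :
    D.Good κ (H.map (MulAut.conj g).toMonoidHom) := by
  have hmem : ∀ x, x ∈ H.map (MulAut.conj g).toMonoidHom ↔ g⁻¹ * x * g ∈ H := fun x => by
    constructor
    · rintro ⟨y, hy, rfl⟩
      simpa [mul_assoc] using hy
    · intro hx
      exact ⟨_, hx, by simp [mul_assoc]⟩
  obtain ⟨⟨A, hA, hHA⟩, hs⟩ := h
  obtain ⟨x, -, hx⟩ := D.exists_rd g
  constructor
  · refine ⟨A ∪ Set.range x, mk_union_lt hκ.le hA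
      (mk_lt_of_countable hκ (Set.countable_range _)), ?_⟩
    obtain ⟨𝒱, h𝒱, hH⟩ := (typeDefinable_iff D).1 hHA
    refine (typeDefinable_iff D).2 ⟨(fun V => {y | g⁻¹ * y * g ∈ V}) '' 𝒱, ?_, ?_⟩
    · rintro _ ⟨V, hV, rfl⟩
      have hg : D.DefTerm (A ∪ Set.range x) (fun _ : Fin D.n → M => g) := by
        rw [← hx]
        exact DefTerm.const fun i => Or.inr ⟨i, rfl⟩
      exact ((h𝒱 V hV).mono Set.subset_union_left).mem ((hg.inv.mul (DefTerm.var id)).mul hg)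
    · ext y
      rw [SetLike.mem_coe, hmem, ← SetLike.mem_coe, hH]
      simp
  · intro P hP U hU hHU
    obtain ⟨N, hN⟩ := hs.not_hasOrder (A := Set.univ) (P := fun z => {y | y * g⁻¹ ∈ P z})
      (U := {y | g * y * g⁻¹ ∈ U})
      ((hP.mono (Set.empty_subset _)).mem
        ((DefTerm.var Sum.inr).mul (DefTerm.constG g).inv) Sum.inl)
      (hU.mem (((DefTerm.constG g).mul (DefTerm.var id)).mul (DefTerm.constG g).inv))
      (fun y hy => hHU ((hmem _).2 (by simpa [mul_assoc] using hy)))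
    refine ⟨N, fun ⟨c, b, hcb⟩ => hN ⟨fun i => c i * g, b, fun i hi j hj => ⟨fun hij => ?_, ?_⟩⟩⟩
    · simpa using (hcb i hi j hj).1 hij
    · rintro hij ⟨u, hu, huP⟩
      refine (hcb i hi j hj).2 hij ⟨_, hu, ?_⟩
      simpa [mul_assoc] using huP

end DefinableGroup

/-! ### Extraction of indiscernible sequences -/

section Indiscernible

variable {L : FirstOrder.Language.{u, v}} {M : Type w} [L.Structure M] [Nonempty M]
  {κ : Cardinal.{w}}

/-- Every sequence of tuples gives rise to an indiscernible sequence having all definable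
properties shared by the increasing subsequences of the original one. -/
theorem IsSaturated.exists_indiscernible (hM : IsSaturated L M κ) (hκ : ℵ₀ < κ) {A : Set M}
    (hA : #A < κ) {γ : Type w''} [Countable γ] (x : ℕ → γ → M) :
    ∃ y : ℕ → γ → M,
      (∀ (k : ℕ) (s t : Fin k → ℕ), StrictMono s → StrictMono t →
        EqType L A (fun q : Fin k × γ => y (s q.1) q.2) (fun q => y (t q.1) q.2)) ∧
      ∀ (k : ℕ) (X : (Fin k × γ → M) → Prop), DefPred L A X →
        (∀ s : Fin k → ℕ, StrictMono s → X (fun q => x (s q.1) q.2)) →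
        ∀ s : Fin k → ℕ, StrictMono s → X (fun q => y (s q.1) q.2) := by
  classical
  let I₁ := Σ k : ℕ, {X : (Fin k × γ → M) → Prop // DefPred L A X} ×
    {s : Fin k → ℕ // StrictMono s} × {s : Fin k → ℕ // StrictMono s}
  let I₂ := Σ k : ℕ, {X : (Fin k × γ → M) → Prop // DefPred L A X ∧
    ∀ s : Fin k → ℕ, StrictMono s → X (fun q => x (s q.1) q.2)} × {s : Fin k → ℕ // StrictMono s}
  let sub : (k : ℕ) → (Fin k → ℕ) → Fin k × γ → ℕ × γ := fun k s q => (s q.1, q.2)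
  let p : I₁ ⊕ I₂ → (ℕ × γ → M) → Prop := Sum.elim
    (fun i z => i.2.1.1 (z ∘ sub i.1 i.2.2.1.1) ↔ i.2.1.1 (z ∘ sub i.1 i.2.2.2.1))
    (fun i z => i.2.1.1 (z ∘ sub i.1 i.2.2.1))
  obtain ⟨z, hz⟩ := hM.compactness_countable hκ hA p (by
    rintro (i | i)
    · exact (i.2.1.2.comp _).iff (i.2.1.2.comp _)
    · exact i.2.1.2.1.comp _) (fun S => by
    -- Finitely many instances of indiscernibility hold along a suitable subsequence of `x` itself,
    -- which also keeps the properties shared by all increasing subsequences.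
    obtain ⟨f, hf, h⟩ := ramsey_finset S.toLeft (fun i => i.1)
      (fun i s => i.2.1.1 (fun q => x (s q.1) q.2))
    refine ⟨fun q => x (f q.1) q.2, ?_⟩
    rintro (i | i) hi
    · rcases h i (Finset.mem_toLeft.2 hi) with h | h
      · exact iff_of_true (h _ i.2.2.1.2) (h _ i.2.2.2.2)
      · exact iff_of_false (h _ i.2.2.1.2) (h _ i.2.2.2.2)
    · exact i.2.1.2.2 (f ∘ i.2.2.1) (hf.comp i.2.2.2))
  refine ⟨fun i j => z (i, j), fun k s t hs ht X hX hXs => ?_, fun k X hX h s hs => ?_⟩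
  · exact (hz (Sum.inl ⟨k, ⟨X, hX⟩, ⟨s, hs⟩, ⟨t, ht⟩⟩)).1 hXs
  · exact hz (Sum.inr ⟨k, ⟨X, hX, h⟩, ⟨s, hs⟩⟩)

end Indiscernible

/-! ### Representatives of pairs of hyperimaginaries -/

section QuotientSets

variable {L : FirstOrder.Language.{u, v}} {M : Type w} [L.Structure M] {A : Set M}
  {α : Type*} {β : Type*}

/-- The set of all `β`-tuples, as a quotient by equality. -/
def trivialQuotient (M : Type w) (β : Type*) : QuotientSet M β where
  carrier := Set.univ
  rel := ⊥

theorem trivialQuotient_isHyperdefinable :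
    (trivialQuotient M β).IsHyperdefinable L A := by
  refine ⟨⟨∅, by simp, by simp [trivialQuotient]⟩,
    Set.range fun i => {p : β ⊕ β → M | p (Sum.inl i) = p (Sum.inr i)}, ?_, ?_⟩
  · rintro _ ⟨i, rfl⟩
    exact DefPred.eq _ _
  · ext p
    constructor
    · rintro ⟨x, y, h, rfl⟩
      obtain rfl : x = y := h
      rintro _ ⟨i, rfl⟩
      rfl
    · intro h
      refine ⟨⟨p ∘ Sum.inl, trivial⟩, ⟨p ∘ Sum.inr, trivial⟩, Subtype.ext ?_, ?_⟩
      · exact funext fun i => h _ ⟨i, rfl⟩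
      · exact (Sum.elim_comp_inl_inr p).symm

/-- The tuples `z` and `z'` represent the same pair of elements of `P` and `Q`. -/
def Equivalent (P : QuotientSet M α) (Q : QuotientSet M β) (z z' : α ⊕ β → M) : Prop :=
  (∃ x x' : P.carrier, P.rel x x' ∧ z ∘ Sum.inl = x.1 ∧ z' ∘ Sum.inl = x'.1) ∧
  ∃ y y' : Q.carrier, Q.rel y y' ∧ z ∘ Sum.inr = y.1 ∧ z' ∘ Sum.inr = y'.1

/-- The tuple `z` represents the pair `(a, b)`. -/
def Represents (P : QuotientSet M α) (Q : QuotientSet M β) (z : α ⊕ β → M) (a : P.Elem)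
    (b : Q.Elem) : Prop :=
  ∃ (x : P.carrier) (y : Q.carrier), P.cls x = a ∧ Q.cls y = b ∧ z = Sum.elim x.1 y.1

variable {P : QuotientSet M α} {Q : QuotientSet M β}

theorem Represents.equivalent {z z' : α ⊕ β → M} {a : P.Elem} {b : Q.Elem}
    (h : Represents P Q z a b) (h' : Represents P Q z' a b) : Equivalent P Q z z' := by
  obtain ⟨x, y, rfl, rfl, rfl⟩ := h
  obtain ⟨x', y', hx, hy, rfl⟩ := h'
  exact ⟨⟨x, x', Quotient.exact hx.symm, rfl, rfl⟩, y, y', Quotient.exact hy.symm, rfl, rfl⟩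

theorem Represents.of_equivalent {z z' : α ⊕ β → M} {a : P.Elem} {b : Q.Elem}
    (h : Represents P Q z a b) (h' : Equivalent P Q z z') : Represents P Q z' a b := by
  obtain ⟨x, y, rfl, rfl, rfl⟩ := h
  obtain ⟨⟨x₁, x', hx, h1, h2⟩, y₁, y', hy, h3, h4⟩ := h'
  obtain rfl : x = x₁ := Subtype.ext h1
  obtain rfl : y = y₁ := Subtype.ext h3
  refine ⟨x', y', Quotient.sound (P.rel.symm' hx), Quotient.sound (Q.rel.symm' hy), ?_⟩
  rw [← h2, ← h4, Sum.elim_comp_inl_inr]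

theorem Equivalent.symm {z z' : α ⊕ β → M} (h : Equivalent P Q z z') : Equivalent P Q z' z := by
  obtain ⟨⟨x, x', hx, h1, h2⟩, y, y', hy, h3, h4⟩ := h
  exact ⟨⟨x', x, P.rel.symm' hx, h2, h1⟩, y', y, Q.rel.symm' hy, h4, h3⟩

theorem Equivalent.trans {z z' z'' : α ⊕ β → M} (h : Equivalent P Q z z')
    (h' : Equivalent P Q z' z'') : Equivalent P Q z z'' := by
  obtain ⟨⟨x, x', hx, h1, h2⟩, y, y', hy, h3, h4⟩ := h
  obtain ⟨⟨x₁, x'', hx', h1', h2'⟩, y₁, y'', hy', h3', h4'⟩ := h'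
  obtain rfl : x' = x₁ := Subtype.ext (h2.symm.trans h1')
  obtain rfl : y' = y₁ := Subtype.ext (h4.symm.trans h3')
  exact ⟨⟨x, x'', P.rel.trans' hx hx', h1, h2'⟩, y, y'', Q.rel.trans' hy hy', h3, h4'⟩

theorem exists_defPred_equivalent (hP : P.IsHyperdefinable L A) (hQ : Q.IsHyperdefinable L A) :
    ∃ (𝓔 : Set (((α ⊕ β) ⊕ (α ⊕ β) → M) → Prop)), (∀ e ∈ 𝓔, DefPred L A e) ∧
      ∀ z z', Equivalent P Q z z' ↔ ∀ e ∈ 𝓔, e (Sum.elim z z') := by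
  obtain ⟨-, 𝒟, h𝒟, hPE⟩ := hP
  obtain ⟨-, 𝒟', h𝒟', hQE⟩ := hQ
  refine ⟨(fun X p => p ∘ Sum.elim (Sum.inl ∘ Sum.inl) (Sum.inr ∘ Sum.inl) ∈ X) '' 𝒟 ∪
    (fun X p => p ∘ Sum.elim (Sum.inl ∘ Sum.inr) (Sum.inr ∘ Sum.inr) ∈ X) '' 𝒟', ?_, ?_⟩
  · rintro _ (⟨X, hX, rfl⟩ | ⟨X, hX, rfl⟩)
    · exact DefPred.comp (h𝒟 X hX) _
    · exact DefPred.comp (h𝒟' X hX) _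
  · intro z z'
    have h1 : (∃ x x' : P.carrier, P.rel x x' ∧ z ∘ Sum.inl = x.1 ∧ z' ∘ Sum.inl = x'.1) ↔
        Sum.elim (z ∘ Sum.inl) (z' ∘ Sum.inl) ∈ ⋂₀ 𝒟 := by
      rw [← hPE]
      refine exists_congr fun x => exists_congr fun x' => and_congr_right fun _ => ?_
      rw [Sum.elim_eq_iff]
    have h2 : (∃ y y' : Q.carrier, Q.rel y y' ∧ z ∘ Sum.inr = y.1 ∧ z' ∘ Sum.inr = y'.1) ↔
        Sum.elim (z ∘ Sum.inr) (z' ∘ Sum.inr) ∈ ⋂₀ 𝒟' := by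
      rw [← hQE]
      refine exists_congr fun x => exists_congr fun x' => and_congr_right fun _ => ?_
      rw [Sum.elim_eq_iff]
    have e1 : Sum.elim z z' ∘ Sum.elim (Sum.inl ∘ Sum.inl) (Sum.inr ∘ Sum.inl) =
        Sum.elim (z ∘ Sum.inl) (z' ∘ Sum.inl) := by
      funext i; rcases i with i | i <;> rfl
    have e2 : Sum.elim z z' ∘ Sum.elim (Sum.inl ∘ Sum.inr) (Sum.inr ∘ Sum.inr) =
        Sum.elim (z ∘ Sum.inr) (z' ∘ Sum.inr) := by
      funext i; rcases i with i | i <;> rfl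
    rw [Equivalent, h1, h2]
    simp only [Set.mem_sInter, Set.mem_union, or_imp, forall_and, Set.forall_mem_image, e1, e2]

theorem SameType.symm {k : Type} {a a' : k → P.Elem} {b b' : k → Q.Elem}
    (h : SameType L A P Q a b a' b') : SameType L A P Q a' b' a b := by
  obtain ⟨x, x', y, y', h, hφ⟩ := h
  exact ⟨x', x, y', y, fun i => ⟨(h i).2.1, (h i).1, (h i).2.2.2, (h i).2.2.1⟩,
    fun φ => (hφ φ).symm⟩

theorem sameType_of_represents {z z' : α ⊕ β → M} {a a' : P.Elem} {b b' : Q.Elem}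
    (h : Represents P Q z a b) (h' : Represents P Q z' a' b') (hz : EqType L A z z') :
    SameType L A P Q (k := Unit) (fun _ => a) (fun _ => b) (fun _ => a') (fun _ => b') := by
  obtain ⟨x, y, rfl, rfl, rfl⟩ := h
  obtain ⟨x', y', rfl, rfl, rfl⟩ := h'
  exact ⟨fun _ => x, fun _ => x', fun _ => y, fun _ => y', fun _ => ⟨rfl, rfl, rfl, rfl⟩,
    eqType_iff_formula.1 (hz.comp Prod.snd)⟩

theorem SameType.exists_represents {k : Type} {a a' : k → P.Elem} {b b' : k → Q.Elem}
    (h : SameType L A P Q a b a' b') (i j : k) : ∃ z z', Represents P Q z (a i) (b j) ∧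
      Represents P Q z' (a' i) (b' j) ∧ EqType L A z z' := by
  obtain ⟨x, x', y, y', h, hφ⟩ := h
  refine ⟨_, _, ⟨x i, y j, (h i).1, (h j).2.2.1, rfl⟩, ⟨x' i, y' j, (h i).2.1, (h j).2.2.2, rfl⟩, ?_⟩
  have H := (eqType_iff_formula.2 hφ).comp (fun c : α ⊕ β =>
    (Sum.elim (fun _ => i) (fun _ => j) c, c))
  convert H using 1 <;> (funext c; rcases c with c | c <;> rfl)

/-- `SameType` only provides some representatives with equal types; this transports any other choice
of representatives, and so makes equalities of types composable. -/
theorem IsSaturated.exists_represents_eqType [Nonempty M] {κ : Cardinal.{w}}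
    (hM : IsSaturated L M κ) (hκ : ℵ₀ ≤ κ)
    (hA : #A < κ) {α : Type w'} {β : Type w''} {P : QuotientSet M α} {Q : QuotientSet M β}
    (hαβ : Cardinal.lift.{w} #(α ⊕ β) < Cardinal.lift.{max w' w''} κ)
    (hP : P.IsHyperdefinable L A) (hQ : Q.IsHyperdefinable L A)
    {x x' y : α ⊕ β → M} (h : EqType L A x x') (hxy : Equivalent P Q x y) :
    ∃ y', Equivalent P Q x' y' ∧ EqType L A y y' := by
  obtain ⟨𝓔, h𝓔, hE⟩ := exists_defPred_equivalent hP hQ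
  have hx' : #(Set.range x') < κ :=
    Cardinal.lift_lt.1 (lt_of_le_of_lt Cardinal.mk_range_le_lift hαβ)
  obtain ⟨y', hy'⟩ := hM.exists_eqType_extend hκ hA hx' hαβ h y
  exact ⟨y', (hE _ _).2 fun e he => hy' e (h𝓔 e he) ((hE _ _).1 hxy e he), hy'.comp Sum.inr⟩

end QuotientSets

/-! ### Stability of `G/H` implies local stability -/

namespace DefinableGroup

variable {L : FirstOrder.Language.{u, v}} {M : Type w} [L.Structure M] [Nonempty M]
  {G : Type w'} [Group G] {D : DefinableGroup L M G} {A B : Set M} {κ : Cardinal.{w}}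

theorem coset_cls_eq_iff {H : Subgroup G} {x y : D.carrier} :
    (D.coset H).cls x = (D.coset H).cls y ↔ (D.rd x.1)⁻¹ * D.rd y.1 ∈ H := by
  rw [D.rd_coe, D.rd_coe, ← QuotientGroup.leftRel_apply]
  exact Quotient.eq

theorem coset_isHyperdefinable {H : Subgroup G} (hH : D.TypeDefinable A (H : Set G)) :
    (D.coset H).IsHyperdefinable L A := by
  obtain ⟨𝒱, h𝒱, hHV⟩ := (typeDefinable_iff D).1 hH
  refine ⟨⟨{D.carrier}, ?_, by simp [coset]⟩, insert {p : Fin D.n ⊕ Fin D.n → M |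
    p ∘ Sum.inl ∈ D.carrier ∧ p ∘ Sum.inr ∈ D.carrier} ((fun V => {p : Fin D.n ⊕ Fin D.n → M |
    (D.rd (p ∘ Sum.inl))⁻¹ * D.rd (p ∘ Sum.inr) ∈ V}) '' 𝒱), ?_, ?_⟩
  · rintro _ rfl
    exact D.defPred_mem_carrier
  · rintro _ (rfl | ⟨V, hV, rfl⟩)
    · exact (D.defPred_mem_carrier.comp _).and (D.defPred_mem_carrier.comp _)
    · exact (h𝒱 V hV).mem ((DefTerm.var _).inv.mul (DefTerm.var _))
  · have hmem : ∀ g, (∀ V ∈ 𝒱, g ∈ V) ↔ g ∈ H := fun g => by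
      rw [← SetLike.mem_coe, hHV, Set.mem_sInter]
    ext p
    rw [Set.sInter_insert, Set.mem_inter_iff]
    simp only [Set.mem_sInter, Set.forall_mem_image, Set.mem_ofPred_eq, hmem]
    constructor
    · rintro ⟨x, y, h, rfl⟩
      exact ⟨⟨x.2, y.2⟩, coset_cls_eq_iff.1 (Quotient.sound h)⟩
    · rintro ⟨⟨hx, hy⟩, h⟩
      exact ⟨⟨_, hx⟩, ⟨_, hy⟩, Quotient.exact (coset_cls_eq_iff.2 h),
        (Sum.elim_comp_inl_inr p).symm⟩

/-- Unbounded patterns give an infinite one and then an indiscernible one. Stability equates the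
types of `(g 0 H, b 1)` and `(g 1 H, b 0)`, but whether some representative, moved by `W`, falls
into `P (b)` tells them apart. Passing to another representative of `g 0 H` costs one more factor
from `W`, hence `W * W ⊆ U`. -/
theorem stableSub_of_isStable (hM : IsSaturated L M κ) (hκ : ℵ₀ < κ) (hA : #A < κ)
    {H : Subgroup G} (hH : D.TypeDefinable A (H : Set G)) (hs : (D.coset H).IsStable L κ A) :
    D.StableSub H := by
  intro P hP U hU hHU
  by_contra! hall
  obtain ⟨W, hW, hHW, -, hWU⟩ := exists_mul_subset hM hκ hA hH hU hHU
  obtain ⟨g, b, hgb⟩ := exists_seq_of_forall_hasOrder hM hκ hP hU hall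
  choose x hxc hx using fun i => D.exists_rd (g i)
  let β := ULift.{w} ℕ
  let bl : Fin D.n → Fin D.n ⊕ β := Sum.inl
  let br : ℕ → Fin D.n ⊕ β := fun i => Sum.inr ⟨i⟩
  obtain ⟨y, hy, hyX⟩ := hM.exists_indiscernible hκ hA
    (fun i => (Sum.elim (x i) (fun j => b i j.down) : Fin D.n ⊕ β → M))
  have hPA : D.DefFam A P := hP.mono (Set.empty_subset _)
  have hRA := hPA.translate hW.defFam
  have hc : ∀ i, y i ∘ bl ∈ D.carrier := fun i =>
    hyX 1 (fun z => z ∘ Prod.mk 0 ∘ bl ∈ D.carrier) (D.defPred_mem_carrier.comp _)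
      (fun s _ => hxc (s 0)) (fun _ => i) (by
        intro a b hab
        exact absurd hab (by simp [Subsingleton.elim a b]))
  have h01 : StrictMono ![0, 1] := by
    intro a b hab
    fin_cases a <;> fin_cases b <;> simp_all
  have hord : D.rd (y 1 ∘ bl) ∈ P (y 0 ∘ br) :=
    hyX 2 (fun z => D.rd (z ∘ Prod.mk 1 ∘ bl) ∈ P (z ∘ Prod.mk 0 ∘ br))
      (hPA.mem (DefTerm.var _) _) (fun s hs => by
        change D.rd (x (s 1)) ∈ P (b (s 0))
        rw [hx]
        exact (hgb _ _).1 (hs (by decide))) _ h01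
  have hord' : ¬ ∃ v ∈ W, D.rd (y 0 ∘ bl) * v ∈ {g | ∃ v ∈ W, g * v ∈ P (y 1 ∘ br)} :=
    hyX 2 (fun z => ¬ (D.rd (z ∘ Prod.mk 0 ∘ bl) ∈
        {g | ∃ v ∈ W, g * v ∈ {g | ∃ v ∈ W, g * v ∈ P (z ∘ Prod.mk 1 ∘ br)}}))
      (DefPred.not ((hRA.translate hW.defFam).mem (DefTerm.var _) _)) (fun s hs => by
        rintro ⟨v, hv, v', hv', h⟩
        change D.rd (x (s 0)) * v * v' ∈ P (b (s 1)) at h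
        rw [hx, mul_assoc] at h
        exact (hgb _ _).2 (hs (by decide)) ⟨_, hWU v hv v' hv', h⟩) _ h01
  let a' : ℕ → (D.coset H).Elem := fun i => (D.coset H).cls ⟨y i ∘ bl, hc i⟩
  let b' : ℕ → (trivialQuotient M β).Elem := fun i =>
    (trivialQuotient M β).cls ⟨y i ∘ Sum.inr, trivial⟩
  have hβ : #β < κ := by
    simpa [β] using hκ
  obtain ⟨z, z', ⟨c, d, hz1, hz2, rfl⟩, ⟨c', d', hz1', hz2', rfl⟩, hzz⟩ :=
    (hs.2 β hβ (trivialQuotient M β) trivialQuotient_isHyperdefinable a' b'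
      (fun k s t hs ht => ⟨fun i => ⟨y (s i) ∘ bl, hc _⟩, fun i => ⟨y (t i) ∘ bl, hc _⟩,
        fun i => ⟨y (s i) ∘ Sum.inr, trivial⟩, fun i => ⟨y (t i) ∘ Sum.inr, trivial⟩,
        fun i => ⟨rfl, rfl, rfl, rfl⟩, eqType_iff_formula.1 (by
          convert hy k s t hs ht using 1 <;>
            (funext q; rcases q with ⟨i, j | j⟩ <;> rfl))⟩) 0 1
      (by decide)).exists_represents () ()
  obtain rfl : d = ⟨y 1 ∘ Sum.inr, trivial⟩ := Quotient.exact hz2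
  obtain rfl : d' = ⟨y 0 ∘ Sum.inr, trivial⟩ := Quotient.exact hz2'
  have h1 := coset_cls_eq_iff.1 hz1'
  have h2 := coset_cls_eq_iff.1 hz1.symm
  obtain ⟨v, hv, hv'⟩ := hzz.symm (fun z => D.rd (z ∘ bl) ∈ {g | ∃ v ∈ W, g * v ∈ P (z ∘ br)})
    (hRA.mem (DefTerm.var _) _) ⟨_, hHW h1, by
      change D.rd c'.1 * _ ∈ P (y 0 ∘ br)
      rwa [mul_inv_cancel_left]⟩
  refine hord' ⟨_, hHW h2, v, hv, ?_⟩
  rw [mul_inv_cancel_left]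
  exact hv'

end DefinableGroup

/-! ### Local stability implies stability of `G/H` -/

namespace DefinableGroup

variable {L : FirstOrder.Language.{u, v}} {M : Type w} [L.Structure M] [Nonempty M]
  {G : Type w'} [Group G] {D : DefinableGroup L M G} {A B : Set M} {κ : Cardinal.{w}}

/-- If the types of `(a i, b j)` and `(a j, b i)` differ, compactness separates them by finitely
many formulas and finitely many approximations to the equivalence relations. By indiscernibility the
separating condition orders the whole sequence, up to a neighbourhood of `H`. -/
theorem sameType_of_stableSub (hM : IsSaturated L M κ) (hκ : ℵ₀ < κ) (hA : #A < κ)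
    {H : Subgroup G} (hH : D.TypeDefinable A (H : Set G)) (hs : D.StableSub H)
    {β : Type w} (hβ : #β < κ) {Q : QuotientSet M β} (hQ : Q.IsHyperdefinable L A)
    {a : ℕ → (D.coset H).Elem} {b : ℕ → Q.Elem} (hab : IsIndiscernible L A (D.coset H) Q a b)
    {i j : ℕ} (hij : i < j) :
    SameType L A (D.coset H) Q (k := Unit) (fun _ => a i) (fun _ => b j)
      (fun _ => a j) (fun _ => b i) := by
  classical
  by_contra hcon
  have hP := coset_isHyperdefinable hH
  obtain ⟨𝓔, h𝓔, hE⟩ := exists_defPred_equivalent hP hQ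
  obtain ⟨𝒱, h𝒱, hHV⟩ := (typeDefinable_iff D).1 hH
  have hmem : ∀ g, (∀ V ∈ 𝒱, g ∈ V) ↔ g ∈ H := fun g => by
    rw [← SetLike.mem_coe, hHV, Set.mem_sInter]
  have hn : Cardinal.lift.{w} #(Fin D.n) < κ := lt_of_lt_of_le (by simp) hκ.le
  have hγ : #(Fin D.n ⊕ β) < κ := by
    rw [Cardinal.mk_sum, Cardinal.lift_uzero]
    exact Cardinal.add_lt_of_lt hκ.le hn hβ
  choose x hx using fun k => Quotient.exists_rep (a k)
  choose y hy using fun k => Quotient.exists_rep (b k)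
  have hrep : ∀ k l, Represents (D.coset H) Q (Sum.elim (x k).1 (y l).1) (a k) (b l) :=
    fun k l => ⟨x k, y l, hx k, hy l, rfl⟩
  set c : Fin D.n ⊕ β → M := Sum.elim (x j).1 (y i).1 with hc
  set c' : Fin D.n ⊕ β → M := Sum.elim (x i).1 (y j).1 with hc'
  have hpair : ∀ k l, k < l →
      (∃ z, Equivalent (D.coset H) Q (Sum.elim (x l).1 (y k).1) z ∧ EqType L A c z) ∧
      ∃ z, Equivalent (D.coset H) Q (Sum.elim (x k).1 (y l).1) z ∧ EqType L A c' z := by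
    intro k l hkl
    have hmono : ∀ {k l : ℕ}, k < l → StrictMono ![k, l] := fun {k l} h p q hpq => by
      fin_cases p <;> fin_cases q <;> simp_all
    have hsame := hab 2 ![i, j] ![k, l] (hmono hij) (hmono hkl)
    constructor
    · obtain ⟨z, z', hz, hz', hzz⟩ := hsame.exists_represents 1 0
      obtain ⟨z'', h1, h2⟩ := hM.exists_represents_eqType hκ.le hA (by simpa using hγ) hP hQ hzz
        (hz.equivalent (hrep j i))
      exact ⟨z'', ((hrep l k).equivalent hz').trans h1, h2⟩
    · obtain ⟨z, z', hz, hz', hzz⟩ := hsame.exists_represents 0 1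
      obtain ⟨z'', h1, h2⟩ := hM.exists_represents_eqType hκ.le hA (by simpa using hγ) hP hQ hzz
        (hz.equivalent (hrep i j))
      exact ⟨z'', ((hrep k l).equivalent hz').trans h1, h2⟩
  -- No pair of hyperimaginaries has representatives of both types; the compactness step below makes
  -- this finitary.
  have hsep : ∀ z' z₁, EqType L A c' z' → EqType L A c z₁ →
      ¬ Equivalent (D.coset H) Q z' z₁ := by
    intro z' z₁ h' h₁ hz
    obtain ⟨z, h1, h2⟩ := hM.exists_represents_eqType hκ.le hA (by simpa using hγ) hP hQ h'.symm hz
    exact hcon (sameType_of_represents ((hrep i j).of_equivalent h1) (hrep j i) (h₁.trans h2).symm)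
  let γ := Fin D.n ⊕ β
  let I₁ := {X : (γ → M) → Prop // DefPred L A X ∧ X c'} ⊕ 𝓔
  let I₂ := {X : (γ → M) → Prop // DefPred L A X ∧ X c} ⊕ 𝓔
  let p₁ : I₁ → (γ ⊕ γ → M) → Prop := Sum.elim (fun X z => X.1 (z ∘ Sum.inl)) (fun e z => e.1 z)
  let p₂ : I₂ → (γ ⊕ γ → M) → Prop := Sum.elim (fun X z => X.1 (z ∘ Sum.inr)) (fun e z => e.1 z)
  have hp₁ : ∀ t, DefPred L A (p₁ t) := by
    rintro (X | e)
    · exact X.2.1.comp _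
    · exact h𝓔 e e.2
  have hp₂ : ∀ t, DefPred L A (p₂ t) := by
    rintro (X | e)
    · exact X.2.1.comp _
    · exact h𝓔 e e.2
  have hp₁' : ∀ z z', Equivalent (D.coset H) Q z z' → EqType L A c' z →
      ∀ t, p₁ t (Sum.elim z z') := by
    rintro z z' h h' (X | e)
    · exact h' _ X.2.1 X.2.2
    · exact (hE _ _).1 h e e.2
  have hp₂' : ∀ z z', Equivalent (D.coset H) Q z z' → EqType L A c z' →
      ∀ t, p₂ t (Sum.elim z z') := by
    rintro z z' h h' (X | e)
    · exact h' _ X.2.1 X.2.2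
    · exact (hE _ _).1 h e e.2
  -- the variables are `z'`, `(x, y)`, `x₁` and `z₁`
  let r₁ : γ ⊕ γ → γ ⊕ (γ ⊕ (Fin D.n ⊕ γ)) := Sum.elim Sum.inl (Sum.inr ∘ Sum.inl)
  let r₂ : γ ⊕ γ → γ ⊕ (γ ⊕ (Fin D.n ⊕ γ)) := Sum.elim (Sum.elim
    (Sum.inr ∘ Sum.inr ∘ Sum.inl) (Sum.inr ∘ Sum.inl ∘ Sum.inr)) (Sum.inr ∘ Sum.inr ∘ Sum.inr)
  have hr₁ : ∀ z : γ ⊕ (γ ⊕ (Fin D.n ⊕ γ)) → M,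
      z ∘ r₁ = Sum.elim (z ∘ Sum.inl) (z ∘ Sum.inr ∘ Sum.inl) := fun z => by
    funext t; rcases t with t | t <;> rfl
  have hr₂ : ∀ z : γ ⊕ (γ ⊕ (Fin D.n ⊕ γ)) → M,
      z ∘ r₂ = Sum.elim (Sum.elim (z ∘ Sum.inr ∘ Sum.inr ∘ Sum.inl)
        (z ∘ Sum.inr ∘ Sum.inl ∘ Sum.inr)) (z ∘ Sum.inr ∘ Sum.inr ∘ Sum.inr) := fun z => by
    funext t; rcases t with (t | t) | t <;> rfl
  -- The inconsistent situation: `z'` of the type of `c'` is equivalent to `(x, y)`, the elements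
  -- given by `x` and `x₁` lie in the same coset of `H`, and `(x₁, y)` is equivalent to `z₁` of the
  -- type of `c`.
  obtain ⟨S, hS⟩ := hM.exists_finset hκ (γ := γ ⊕ (γ ⊕ (Fin D.n ⊕ γ))) (by
      have h1 : #(γ ⊕ (γ ⊕ (Fin D.n ⊕ γ))) < κ := by
        simp only [Cardinal.mk_sum, Cardinal.lift_uzero, Cardinal.lift_id]
        exact Cardinal.add_lt_of_lt hκ.le hγ (Cardinal.add_lt_of_lt hκ.le hγ
          (Cardinal.add_lt_of_lt hκ.le hn hγ))
      simpa using h1) hA (ι := I₁ ⊕ (I₂ ⊕ 𝒱))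
    (p := Sum.elim (fun t z => p₁ t (z ∘ r₁)) (Sum.elim (fun t z => p₂ t (z ∘ r₂))
      (fun V z => (D.rd (z ∘ Sum.inr ∘ Sum.inl ∘ Sum.inl))⁻¹ *
        D.rd (z ∘ Sum.inr ∘ Sum.inr ∘ Sum.inl) ∈ V.1))) (by
      rintro (t | t | V)
      · exact (hp₁ t).comp _
      · exact (hp₂ t).comp _
      · exact (h𝒱 _ V.2).mem ((DefTerm.var _).inv.mul (DefTerm.var _)))
    (q := fun _ => False) (DefPred.const _) (fun z hz => by
      have hH' : (D.rd (z ∘ Sum.inr ∘ Sum.inl ∘ Sum.inl))⁻¹ *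
          D.rd (z ∘ Sum.inr ∘ Sum.inr ∘ Sum.inl) ∈ H :=
        (hmem _).1 fun V hV => hz (Sum.inr (Sum.inr ⟨V, hV⟩))
      have e1 : Equivalent (D.coset H) Q (z ∘ Sum.inl) (z ∘ Sum.inr ∘ Sum.inl) :=
        (hE _ _).2 fun e he => by
          have := hz (Sum.inl (Sum.inr ⟨e, he⟩))
          change e (z ∘ r₁) at this
          rwa [hr₁] at this
      have e2 : Equivalent (D.coset H) Q (Sum.elim (z ∘ Sum.inr ∘ Sum.inr ∘ Sum.inl)
          (z ∘ Sum.inr ∘ Sum.inl ∘ Sum.inr)) (z ∘ Sum.inr ∘ Sum.inr ∘ Sum.inr) :=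
        (hE _ _).2 fun e he => by
          have := hz (Sum.inr (Sum.inl (Sum.inr ⟨e, he⟩)))
          change e (z ∘ r₂) at this
          rwa [hr₂] at this
      have e3 : Equivalent (D.coset H) Q (z ∘ Sum.inr ∘ Sum.inl) (Sum.elim
          (z ∘ Sum.inr ∘ Sum.inr ∘ Sum.inl) (z ∘ Sum.inr ∘ Sum.inl ∘ Sum.inr)) := by
        obtain ⟨⟨-, u, -, -, hu⟩, -, v, -, -, hv⟩ := e1
        obtain ⟨⟨u', -, -, hu', -⟩, -⟩ := e2
        refine ⟨⟨u, u', Quotient.exact (coset_cls_eq_iff.2 ?_), hu, hu'⟩, v, v,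
          Q.rel.refl' v, hv, hv⟩
        rw [← hu, ← hu']
        exact hH'
      exact hsep (z ∘ Sum.inl) (z ∘ Sum.inr ∘ Sum.inr ∘ Sum.inr)
        (fun X hX hXc => hz (Sum.inl (Sum.inl ⟨X, hX, hXc⟩)))
        (fun X hX hXc => hz (Sum.inr (Sum.inl (Sum.inl ⟨X, hX, hXc⟩)))) ((e1.trans e3).trans e2))
  have hS' : ∀ z z' x₁ z₁, (∀ t ∈ S.toLeft, p₁ t (Sum.elim z z')) →
      (∀ t ∈ S.toRight.toLeft, p₂ t (Sum.elim (Sum.elim x₁ (z' ∘ Sum.inr)) z₁)) →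
      ¬ ∀ V ∈ S.toRight.toRight, (D.rd (z' ∘ Sum.inl))⁻¹ * D.rd x₁ ∈ V.1 := by
    intro z z' x₁ z₁ h₁ h₂ h₃
    refine hS (Sum.elim z (Sum.elim z' (Sum.elim x₁ z₁))) ?_
    rintro (t | t | V) ht
    · change p₁ t (_ ∘ r₁)
      rw [hr₁]
      exact h₁ t (Finset.mem_toLeft.2 ht)
    · change p₂ t (_ ∘ r₂)
      rw [hr₂]
      exact h₂ t (Finset.mem_toLeft.2 (Finset.mem_toRight.2 ht))
    · exact h₃ V (Finset.mem_toRight.2 (Finset.mem_toRight.2 ht))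
  -- `P y` collects the `g` for which `(g, y)` looks, as far as `S` can tell, like a pair equivalent
  -- to one of the type of `c`.
  let P : (β → M) → Set G := fun y => {g | ∃ q : Fin D.n ⊕ γ → M, D.rd (q ∘ Sum.inl) = g ∧
    ∀ t : S.toRight.toLeft, p₂ t.1 (Sum.elim (Sum.elim (q ∘ Sum.inl) y) (q ∘ Sum.inr))}
  have hPdef : D.DefFam A P := by
    refine DefPred.ex (DefPred.and ?_ (DefPred.finite_all fun t => ?_))
    · exact DefTerm.eq (DefTerm.var (Sum.inr ∘ Sum.inl)) (DefTerm.var (Sum.inl ∘ Sum.inr))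
    · refine ((hp₂ t.1).comp (Sum.elim (Sum.elim (Sum.inr ∘ Sum.inl) (Sum.inl ∘ Sum.inl))
        (Sum.inr ∘ Sum.inr))).congr fun z => iff_of_eq (congrArg _ ?_)
      funext t; rcases t with (t | t) | t <;> rfl
  obtain ⟨N, hN⟩ := hs.not_hasOrder hPdef
    (U := {g | ∀ V ∈ S.toRight.toRight, g ∈ V.1})
    (GDef.finset_inter (fun V => (h𝒱 _ V.2).mono (Set.subset_univ _)) _)
    (fun g hg V _ => (hmem g).2 hg _ V.2)
  refine hN ⟨fun k => D.rd (x k).1, fun k => (y k).1, fun k _ l _ => ⟨fun hlk => ?_, fun hkl => ?_⟩⟩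
  · obtain ⟨z, h1, h2⟩ := (hpair l k hlk).1
    exact ⟨Sum.elim (x k).1 z, rfl, fun t => hp₂' _ _ h1 h2 _⟩
  · rintro ⟨u, hu, q, hq, hqt⟩
    obtain ⟨z, h1, h2⟩ := (hpair k l hkl).2
    refine hS' z (Sum.elim (x k).1 (y l).1) (q ∘ Sum.inl) (q ∘ Sum.inr)
      (fun t _ => hp₁' _ _ h1.symm h2 t) (fun t ht => hqt ⟨t, ht⟩) fun V hV => ?_
    rw [hq]
    change (D.rd (x k).1)⁻¹ * _ ∈ _
    rw [inv_mul_cancel_left]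
    exact hu V hV

theorem isStable_of_stableSub (hM : IsSaturated L M κ) (hκ : ℵ₀ < κ) (hA : #A < κ)
    {H : Subgroup G} (hH : D.TypeDefinable A (H : Set G)) (hs : D.StableSub H) :
    (D.coset H).IsStable L κ A := by
  refine ⟨coset_isHyperdefinable hH, fun β hβ Q hQ a b hab i j hij => ?_⟩
  rcases lt_or_gt_of_ne hij with h | h
  · exact sameType_of_stableSub hM hκ hA hH hs hβ hQ hab h
  · exact (sameType_of_stableSub hM hκ hA hH hs hβ hQ hab h).symm

end DefinableGroup

/-! ### Chains of neighbourhoods, and the use of NIP -/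

/-- A decreasing sequence of symmetric neighbourhoods of the identity whose intersection is a
subgroup, because `U (n + 1) * U (n + 1) ⊆ U n`. -/
structure IsSubgroupChain {G : Type*} [Group G] (U : ℕ → Set G) : Prop where
  one_mem : ∀ n, 1 ∈ U n
  inv_mem : ∀ n, ∀ x ∈ U n, x⁻¹ ∈ U n
  mul_mem : ∀ n, ∀ x ∈ U (n + 1), ∀ y ∈ U (n + 1), x * y ∈ U n

namespace IsSubgroupChain

variable {G : Type*} [Group G] {U : ℕ → Set G} (hU : IsSubgroupChain U)

include hU

theorem antitone : Antitone U := antitone_nat_of_succ_le fun n x hx => by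
  have := hU.mul_mem n x hx 1 (hU.one_mem _)
  rwa [mul_one] at this

/-- Splitting off the last factor costs one level of the chain, so depth `k` suffices for `k`
factors. -/
theorem list_prod_mem {a : ℕ → G} : ∀ k m, (∀ i < k, a i ∈ U (m + k)) →
    ((List.range k).map a).prod ∈ U m
  | 0, m, _ => by simpa using hU.one_mem m
  | k + 1, m, h => by
    rw [List.range_succ, List.map_append, List.prod_append, List.map_singleton,
      List.prod_singleton]
    refine hU.mul_mem m _ (list_prod_mem k (m + 1) fun i hi => ?_) _ ?_
    · rw [show m + 1 + k = m + (k + 1) by omega]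
      exact h i (by omega)
    · exact hU.antitone (by omega) (h k (by omega))

theorem exists_list_prod_eq {a : ℕ → G} : ∀ k m j, j < k →
    (∀ i < k, i ≠ j → a i ∈ U (m + k)) →
    ∃ x ∈ U m, ∃ y ∈ U m, ((List.range k).map a).prod = x * a j * y
  | 0, _, _, hj, _ => absurd hj (by omega)
  | k + 1, m, j, hj, h => by
    rw [List.range_succ, List.map_append, List.prod_append, List.map_singleton,
      List.prod_singleton]
    rcases Nat.lt_succ_iff_lt_or_eq.1 hj with hj | rfl
    · obtain ⟨x, hx, y, hy, hxy⟩ := exists_list_prod_eq k (m + 1) j hj fun i hi hij => by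
        rw [show m + 1 + k = m + (k + 1) by omega]
        exact h i (by omega) hij
      refine ⟨x, hU.antitone (by omega) hx, y * a k,
        hU.mul_mem m _ hy _ (hU.antitone (by omega) (h k (by omega) (by omega))), ?_⟩
      rw [hxy, mul_assoc (x * a j)]
    · refine ⟨_, hU.list_prod_mem j m fun i hi => ?_, 1, hU.one_mem m, (mul_one _).symm⟩
      exact hU.antitone (by omega) (h i (by omega) (by omega))

end IsSubgroupChain

namespace DefinableGroup

variable {L : FirstOrder.Language.{u, v}} {M : Type w} [L.Structure M] [Nonempty M]
  {G : Type w'} [Group G] {D : DefinableGroup L M G} {A B : Set M} {κ : Cardinal.{w}}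

/-- In an NIP theory, for a uniformly definable family of chains there is a bound on the length
of sequences `(g p, c p)` with `g p` deep in the chains of parameter `c q` for `q ≠ p`, but outside
a fixed member of the chain of parameter `c p`. -/
theorem exists_forall_not_of_isNIP {T : L.Theory} (hT : IsNIP.{u, v, w} T) [M ⊨ T]
    {𝒰 : ℕ → (ℕ → M) → Set G} (h𝒰 : ∀ n, D.DefFam ∅ (𝒰 n)) (s : ℕ) :
    ∃ d, ∀ (g : Fin d → G) (c : Fin d → ℕ → M),
      (∀ p, IsSubgroupChain fun n => 𝒰 n (c p)) →
      (∀ p q, q ≠ p → g p ∈ 𝒰 (s + 2 + d) (c q)) → ∃ p, g p ∈ 𝒰 s (c p) := by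
  classical
  obtain ⟨φ, hφ⟩ := Set.empty_definable_iff.1 (h𝒰 (s + 2))
  let m := φ.freeVarFinset.sup (Sum.elim (fun i => i + 1) fun _ => 0)
  have hm : ∀ i, Sum.inl i ∈ φ.freeVarFinset → i < m := fun i hi =>
    Finset.le_sup (f := (Sum.elim (fun i => i + 1) fun _ => 0 : ℕ ⊕ Fin D.n → ℕ)) hi
  let f : φ.freeVarFinset → Fin m ⊕ Fin D.n := fun x => match x with
    | ⟨Sum.inl i, hi⟩ => Sum.inl ⟨i, hm i hi⟩
    | ⟨Sum.inr j, _⟩ => Sum.inr j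
  have key : ∀ (c : ℕ → M) (x : Fin D.n → M),
      (φ.restrictFreeVar f).Realize (Sum.elim (fun i : Fin m => c i) x) default ↔
        D.rd x ∈ 𝒰 (s + 2) c := fun c x => by
    refine Iff.trans (Language.BoundedFormula.realize_restrictFreeVar (v' := Sum.elim c x) ?_)
      (Set.ext_iff.1 hφ (Sum.elim c x)).symm
    rintro ⟨i | j, hj⟩ <;> rfl
  obtain ⟨d, hd⟩ := hT M m D.n (φ.restrictFreeVar f)
  refine ⟨d, fun g c hc hg => ?_⟩
  by_contra! hg'
  -- The product attached to `S` omits the `g i` with `i ∈ S`. If `p ∈ S`, all factors are deep in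
  -- the chain of `c p`, and the product lies in level `s + 2`. If `p ∉ S`, it is `y * g p * z` with
  -- `y` and `z` in level `s + 2`, and were it in that level too, `g p` would be in level `s`. So
  -- level `s + 2` would shatter the `c p`.
  let a : Set (Fin d) → ℕ → G := fun S i =>
    if h : i < d then if (⟨i, h⟩ : Fin d) ∈ S then 1 else g ⟨i, h⟩ else 1
  choose x _ hx using fun S => D.exists_rd ((List.range d).map (a S)).prod
  refine hd ⟨fun p i => c p i, x, fun p S => (key (c p) (x S)).trans ?_⟩
  rw [hx]
  constructor
  · intro h
    by_contra hp
    obtain ⟨y, hy, z, hz, hyz⟩ := (hc p).exists_list_prod_eq (a := a S) d (s + 2) p.val p.2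
      fun i hi hip => by
        simp only [a, dif_pos hi]
        split_ifs with hiS
        · exact (hc p).one_mem _
        · exact hg _ _ fun h => hip (congrArg Fin.val h).symm
    rw [hyz] at h
    simp only [a, dif_pos p.2, Fin.eta, if_neg hp] at h
    refine hg' p ?_
    have h1 := (hc p).mul_mem (s + 1) _ ((hc p).inv_mem _ _ hy) _ h
    have h2 := (hc p).mul_mem s _ h1 _ ((hc p).antitone (Nat.le_succ (s + 1))
      ((hc p).inv_mem _ _ hz))
    simpa [mul_assoc] using h2
  · intro hp
    refine (hc p).list_prod_mem d (s + 2) fun i hi => ?_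
    simp only [a, dif_pos hi]
    split_ifs with hiS
    · exact (hc p).one_mem _
    · exact hg _ _ fun h => hiS (h ▸ hp)

/-- A family of subgroups with stable coset spaces, uniformly type-definable over parameters
ranging over a type-definable set. -/
structure UniformFamily (D : DefinableGroup L M G) (κ : Cardinal.{w}) where
  /-- the neighbourhoods of the subgroup with a given parameter -/
  nbhd : ℕ → (ℕ → M) → Set G
  nbhd_def : ∀ n, D.DefFam ∅ (nbhd n)
  /-- the conditions on the parameters -/
  conds : Set ((ℕ → M) → Prop)
  conds_def : ∀ X ∈ conds, DefPred L (∅ : Set M) X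
  /-- the subgroup with a given parameter -/
  subgroup : (ℕ → M) → Subgroup G
  chain : ∀ c, (∀ X ∈ conds, X c) → IsSubgroupChain fun n => nbhd n c
  mem_subgroup : ∀ c, (∀ X ∈ conds, X c) → ∀ x, x ∈ subgroup c ↔ ∀ n, x ∈ nbhd n c
  good : ∀ c, (∀ X ∈ conds, X c) → D.Good κ (subgroup c)

namespace UniformFamily

variable (F : D.UniformFamily κ)

/-- The set of parameters of the family. -/
def index : Set (ℕ → M) := {c | ∀ X ∈ F.conds, X c}

/-- The compactness step of `not_exists_seq`. -/
theorem exists_seq_separated (hM : IsSaturated L M κ) (hκ : ℵ₀ < κ) {d s t : ℕ} (p : Fin (d + 1))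
    (g : ℕ → G) (c : ℕ → ℕ → M) (hc : ∀ i, c i ∈ F.index)
    (hlt : ∀ i j, j < i → g i ∈ F.subgroup (c j))
    (hsep : ∀ σ : Fin (d + 1) → ℕ, StrictMono σ →
      ¬ ∃ v, (∀ q, v ∈ F.nbhd t (c (σ (p.succAbove q)))) ∧ g (σ p) * v ∈ F.nbhd s (c (σ p))) :
    ∃ (e : Fin d → ℕ → M) (g' : ℕ → G) (c' : ℕ → ℕ → M), (∀ q, e q ∈ F.index) ∧
      (∀ i, c' i ∈ F.index) ∧ (∀ i j, j < i → g' i ∈ F.subgroup (c' j)) ∧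
      ∀ i, ¬ ∃ v, (∀ q, v ∈ F.nbhd t (e q)) ∧ g' i * v ∈ F.nbhd s (c' i) := by
  classical
  let γ := (Fin d × ℕ) ⊕ ((ℕ × ℕ) ⊕ (ℕ × Fin D.n))
  let ve : Fin d → ℕ → γ := fun q => Sum.inl ∘ Prod.mk q
  let vc : ℕ → ℕ → γ := fun i => Sum.inr ∘ Sum.inl ∘ Prod.mk i
  let vg : ℕ → Fin D.n → γ := fun i => Sum.inr ∘ Sum.inr ∘ Prod.mk i
  have hB : #(∅ : Set M) < κ := mk_lt_of_countable hκ Set.countable_empty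
  obtain ⟨z, hz⟩ := hM.compactness_countable hκ hB (γ := γ)
    (ι := (F.conds × Fin d) ⊕ ((F.conds × ℕ) ⊕ ((ℕ × {q : ℕ × ℕ // q.2 < q.1}) ⊕ ℕ)))
    (Sum.elim (fun k z => k.1.1 (z ∘ ve k.2)) (Sum.elim (fun k z => k.1.1 (z ∘ vc k.2))
      (Sum.elim (fun k z => D.rd (z ∘ vg k.2.1.1) ∈ F.nbhd k.1 (z ∘ vc k.2.1.2))
        (fun i z => ¬ ∃ v, (∀ q, v ∈ F.nbhd t (z ∘ ve q)) ∧
          D.rd (z ∘ vg i) * v ∈ F.nbhd s (z ∘ vc i))))) (by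
      rintro (k | k | k | i)
      · exact (F.conds_def _ k.1.2).comp _
      · exact (F.conds_def _ k.1.2).comp _
      · exact (F.nbhd_def _).mem (DefTerm.var _) _
      · refine DefPred.not (DefPred.exG (D := D) (p := fun (z : γ → M) v =>
          (∀ q, v ∈ F.nbhd t (z ∘ ve q)) ∧ D.rd (z ∘ vg i) * v ∈ F.nbhd s (z ∘ vc i))
          (DefPred.and (DefPred.finite_all fun q => ?_) ?_))
        · exact (F.nbhd_def t).mem (DefTerm.var Sum.inr) (Sum.inl ∘ ve q)
        · exact (F.nbhd_def s).mem ((DefTerm.var (Sum.inl ∘ vg i)).mul (DefTerm.var Sum.inr))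
            (Sum.inl ∘ vc i)) (fun S => by
      choose x _ hx using fun i => D.exists_rd (g i)
      -- `N` bounds the indices at which separation is demanded. The fixed parameters `e` are the
      -- terms of `c` before place `p` and terms beyond `p + N`; the new sequence starts at `p`, so
      -- its terms up to `N` lie between them.
      let N := S.sup (Sum.elim (fun _ => 0) (Sum.elim (fun _ => 0) (Sum.elim (fun _ => 0) id)))
      let τ : Fin d → ℕ := fun q => if q.val < p.val then q.val else p.val + N + q.val + 1
      refine ⟨Sum.elim (fun k => c (τ k.1) k.2) (Sum.elim (fun k => c (p.val + k.1) k.2)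
        (fun k => x (p.val + k.1) k.2)), ?_⟩
      rintro (k | k | k | i) hi
      · exact hc (τ k.2) _ k.1.2
      · exact hc (p.val + k.2) _ k.1.2
      · change D.rd (x (p.val + k.2.1.1)) ∈ F.nbhd k.1 (c (p.val + k.2.1.2))
        rw [hx]
        exact (F.mem_subgroup _ (hc _) _).1 (hlt _ _ (Nat.add_lt_add_left k.2.2 _)) _
      · have hiN : i ≤ N := Finset.le_sup (f := (Sum.elim (fun _ => 0) (Sum.elim (fun _ => 0)
          (Sum.elim (fun _ => 0) id)) : (F.conds × Fin d) ⊕ ((F.conds × ℕ) ⊕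
            ((ℕ × {q : ℕ × ℕ // q.2 < q.1}) ⊕ ℕ)) → ℕ)) hi
        let σ : Fin (d + 1) → ℕ := fun k => if k.val < p.val then k.val else
          if k.val = p.val then p.val + i else p.val + N + k.val
        have hσ : StrictMono σ := fun a b hab => by
          have : a.val < b.val := hab
          simp only [σ]
          split_ifs <;> omega
        have hσp : σ p = p.val + i := by simp [σ]
        have hστ : ∀ q, σ (p.succAbove q) = τ q := fun q => by
          by_cases h : q.val < p.val
          · rw [Fin.succAbove_of_castSucc_lt _ _ h]
            simp only [σ, τ, Fin.val_castSucc, if_pos h]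
          · rw [Fin.succAbove_of_le_castSucc _ _ (not_lt.1 h)]
            simp only [σ, τ, Fin.val_succ, if_neg h]
            rw [if_neg (by omega), if_neg (by omega)]
            omega
        have := hsep σ hσ
        simp only [hσp, hστ] at this
        rw [← hx] at this
        exact this)
  have hzc : ∀ i, z ∘ vc i ∈ F.index := fun i X hX => hz (Sum.inr (Sum.inl (⟨X, hX⟩, i)))
  refine ⟨fun q => z ∘ ve q, fun i => D.rd (z ∘ vg i), fun i => z ∘ vc i, fun q X hX => ?_,
    hzc, fun i j hij => ?_, fun i => ?_⟩
  · exact hz (Sum.inl (⟨X, hX⟩, q))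
  · exact (F.mem_subgroup _ (hzc j) _).2 fun m =>
      hz (Sum.inr (Sum.inr (Sum.inl (m, ⟨(i, j), hij⟩))))
  · exact hz (Sum.inr (Sum.inr (Sum.inr i)))

/-- The NIP bound needs each `g i` to be deep in the chains of both earlier and later parameters.
Ramsey gives two cases: either each `g i` can be replaced by a suitable `v` without changing its
position relative to its own chain, or it is separated from finitely many chains, and these supply
the stable subgroup to which the shift is applied. -/
theorem not_exists_seq (hM : IsSaturated L M κ) (hκ : ℵ₀ < κ) {T : L.Theory}
    (hT : IsNIP.{u, v, w} T) [M ⊨ T] (r : ℕ) (g : ℕ → G) (c : ℕ → ℕ → M)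
    (hc : ∀ i, c i ∈ F.index) (hlt : ∀ i j, j < i → g i ∈ F.subgroup (c j)) :
    ∃ i, g i ∈ F.nbhd r (c i) := by
  by_contra! hr
  obtain ⟨d, hd⟩ := exists_forall_not_of_isNIP hT F.nbhd_def (r + 1)
  rcases d with _ | d
  · obtain ⟨p, -⟩ := hd Fin.elim0 Fin.elim0 (fun p => p.elim0) (fun p => p.elim0)
    exact p.elim0
  set t := r + 1 + 2 + (d + 1) with ht
  obtain ⟨f, hf, hfp⟩ := ramsey_finset (Finset.univ : Finset (Fin (d + 1))) (fun _ => d + 1)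
    (fun p σ => ∃ v, (∀ q, v ∈ F.nbhd t (c (σ (p.succAbove q)))) ∧
      g (σ p) * v ∈ F.nbhd (r + 1) (c (σ p)))
  have hval : StrictMono (Fin.val : Fin (d + 1) → ℕ) := fun _ _ h => h
  by_cases hall : ∀ p : Fin (d + 1), ∀ σ : Fin (d + 1) → ℕ, StrictMono σ →
    ∃ v, (∀ q, v ∈ F.nbhd t (c (f (σ (p.succAbove q))))) ∧
      g (f (σ p)) * v ∈ F.nbhd (r + 1) (c (f (σ p)))
  -- Here the bound applies to the `v p`: one of them lies in level `r + 1` of its own chain, and so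
  -- does `g * v p`, which puts `g` in level `r`.
  · choose v hv hv' using fun p => hall p _ hval
    obtain ⟨p, hp⟩ := hd v (fun p => c (f p.val)) (fun p => F.chain _ (hc _)) (fun p q hqp => by
      obtain ⟨q', rfl⟩ := Fin.exists_succAbove_eq hqp
      exact hv p q')
    have hch := F.chain _ (hc (f p.val))
    have := hch.mul_mem r _ (hv' p) _ (hch.inv_mem _ _ hp)
    rw [mul_inv_cancel_right] at this
    exact hr _ this
  · push Not at hall
    obtain ⟨p, σ, hσ, hpσ⟩ := hall
    have hsep := (hfp p (Finset.mem_univ _)).resolve_left fun h => by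
      obtain ⟨v, hv, hv'⟩ := h σ hσ
      exact hpσ v hv hv'
    obtain ⟨e, g', c', he, hc', hlt', hsep'⟩ := F.exists_seq_separated hM hκ p (g ∘ f) (c ∘ f)
      (fun i => hc _) (fun i j hij => hlt _ _ (hf hij)) hsep
    -- This is a neighbourhood of the good subgroup `⨅ q, F.subgroup (e q)`. Shifting from the last
    -- place, where membership in all the earlier chains is known, corrects each `g'` by an element
    -- of it so that the bound applies; the conclusion contradicts separation.
    have hV : D.GDef Set.univ {v | ∀ q : Fin d, v ∈ F.nbhd t (e q)} :=
      DefPred.finite_all fun q => (F.nbhd_def t).gdef (Set.empty_subset _) fun _ => trivial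
    have hK : D.Good κ (⨅ q ∈ Finset.univ, F.subgroup (e q)) :=
      Good.finset_inf hM hκ (fun q => F.good _ (he q)) _
    obtain ⟨f', hf', hshift⟩ := hK.exists_strictMono_shift hM hκ (A := ∅) (d := d)
      (Q := fun y => {x | ∀ q, x ∈ F.nbhd t (y q)})
      (DefPred.finite_all fun q => (F.nbhd_def t).mem (DefTerm.var Sum.inr)
        (Sum.inl ∘ Prod.mk q)) hV (fun x hx q => by
        simp only [SetLike.mem_coe, Subgroup.mem_iInf, Finset.mem_univ, true_imp_iff] at hx
        exact (F.mem_subgroup _ (he q) _).1 (hx q) _) g' c' (Fin.last d) (fun σ hσ q => by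
        rw [Fin.succAbove_last]
        exact (F.mem_subgroup _ (hc' _) _).1 (hlt' _ _ (hσ (Fin.castSucc_lt_last q))) _)
    choose v hv hv' using fun p => hshift p (Fin.le_last p) _ hval
    obtain ⟨p, hp⟩ := hd (fun p => g' (f' p.val) * v p) (fun p => c' (f' p.val))
      (fun p => F.chain _ (hc' _)) (fun p q hqp => by
        obtain ⟨q', rfl⟩ := Fin.exists_succAbove_eq hqp
        exact hv' p q')
    exact hsep' _ ⟨v p, hv p, hp⟩

end UniformFamily

end DefinableGroup

/-! ### Removing the parameters -/

namespace DefinableGroup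

variable {L : FirstOrder.Language.{u, v}} {M : Type w} [L.Structure M] [Nonempty M]
  {G : Type w'} [Group G] {D : DefinableGroup L M G} {A B : Set M} {κ : Cardinal.{w}}

namespace UniformFamily

variable (F : D.UniformFamily κ)

/-- Otherwise one chooses successively elements and parameters forming a sequence excluded by
`not_exists_seq`. -/
theorem exists_finset_subset_nbhd (hM : IsSaturated L M κ) (hκ : ℵ₀ < κ) {T : L.Theory}
    (hT : IsNIP.{u, v, w} T) [M ⊨ T] (n : ℕ) :
    ∃ s : Finset (ℕ → M), (∀ c ∈ s, c ∈ F.index) ∧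
      ∀ x, (∀ c ∈ s, x ∈ F.subgroup c) → ∀ c ∈ F.index, x ∈ F.nbhd n c := by
  classical
  by_contra! hcon
  obtain ⟨f, hf, hf'⟩ := exists_seq_of_forall_finset_exists
    (fun q : G × (ℕ → M) => q.2 ∈ F.index ∧ q.1 ∉ F.nbhd n q.2)
    (fun q q' => q'.1 ∈ F.subgroup q.2) (fun S hS => by
      obtain ⟨x, hx, c, hc, hxc⟩ := hcon (S.image Prod.snd) (by
        intro c hc
        obtain ⟨q, hq, rfl⟩ := Finset.mem_image.1 hc
        exact (hS q hq).1)
      exact ⟨(x, c), ⟨hc, hxc⟩, fun q hq => hx _ (Finset.mem_image_of_mem _ hq)⟩)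
  obtain ⟨i, hi⟩ := F.not_exists_seq hM hκ hT n (fun i => (f i).1) (fun i => (f i).2)
    (fun i => (hf i).1) (fun i j hij => hf' j i hij)
  exact (hf i).2 hi

theorem exists_stable_inter (hM : IsSaturated L M κ) (hκ : ℵ₀ < κ) {T : L.Theory}
    (hT : IsNIP.{u, v, w} T) [M ⊨ T] :
    ∃ K : Subgroup G, D.TypeDefinable ∅ (K : Set G) ∧ D.StableSub K ∧
      ∀ x, x ∈ K ↔ ∀ c ∈ F.index, x ∈ F.subgroup c := by
  classical
  choose s hs hsn using F.exists_finset_subset_nbhd hM hκ hT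
  let I : Set (ℕ → M) := ⋃ n, (s n : Set (ℕ → M))
  have hI : I.Countable := Set.countable_iUnion fun n => (s n).countable_toSet
  have hIF : ∀ c ∈ I, c ∈ F.index := fun c hc => by
    obtain ⟨n, hn⟩ := Set.mem_iUnion.1 hc
    exact hs n c hn
  let A : Set M := ⋃ c ∈ I, Set.range c
  have hA : #A < κ :=
    mk_lt_of_countable hκ (hI.biUnion fun c _ => Set.countable_range c)
  have hnbhd : ∀ k : I × ℕ, D.GDef A (F.nbhd k.2 k.1.1) := fun k =>
    (F.nbhd_def k.2).gdef (Set.empty_subset _) fun i =>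
      Set.mem_biUnion k.1.2 ⟨i, rfl⟩
  let K : Subgroup G := ⨅ c ∈ F.index, F.subgroup c
  have hK : ∀ x, x ∈ K ↔ ∀ c ∈ F.index, x ∈ F.subgroup c := fun x => by
    simp [K, Subgroup.mem_iInf]
  -- Finitely many parameters for each level, countably many in all, already determine `K`.
  have hK' : ∀ x, (∀ k : I × ℕ, x ∈ F.nbhd k.2 k.1.1) → x ∈ K := fun x hx => by
    refine (hK x).2 fun c hc => (F.mem_subgroup c hc x).2 fun n => hsn n x (fun c' hc' => ?_) c hc
    exact (F.mem_subgroup c' (hs n c' hc') x).2 fun m =>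
      hx (⟨c', Set.mem_iUnion.2 ⟨n, hc'⟩⟩, m)
  refine ⟨K, ?_, ?_, hK⟩
  -- `K` is small-type-definable, so by compactness finitely many conditions on `c` suffice at level
  -- `n`. Quantifying over all `c` satisfying them defines `K` without parameters.
  · have hfin : ∀ n, ∃ S : Finset F.conds, ∀ x ∈ K, ∀ c, (∀ X ∈ S, X.1 c) → x ∈ F.nbhd n c :=
      fun n => by
      obtain ⟨S, hS⟩ := hM.exists_finset hκ (γ := Fin D.n ⊕ ℕ) (lift_mk_lt_of_countable hκ _) hA
        (ι := (I × ℕ) ⊕ F.conds)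
        (p := Sum.elim (fun k z => D.rd (z ∘ Sum.inl) ∈ F.nbhd k.2 k.1.1)
          (fun X z => X.1 (z ∘ Sum.inr))) (by
          rintro (k | X)
          · exact (hnbhd k).mem (DefTerm.var _)
          · exact ((F.conds_def _ X.2).mono (Set.empty_subset _)).comp _)
        (q := fun z => D.rd (z ∘ Sum.inl) ∈ F.nbhd n (z ∘ Sum.inr))
        (((F.nbhd_def n).mono (Set.empty_subset _)).mem (DefTerm.var _) _) (fun z hz =>
          have hc : z ∘ Sum.inr ∈ F.index := fun X hX => hz (Sum.inr ⟨X, hX⟩)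
          (F.mem_subgroup _ hc _).1 ((hK _).1 (hK' _ fun k => hz (Sum.inl k)) _ hc) n)
      refine ⟨S.toRight, fun x hx c hc => ?_⟩
      obtain ⟨y, -, rfl⟩ := D.exists_rd x
      refine hS (Sum.elim y c) ?_
      rintro (k | X) hk
      · have hkI := hIF _ k.1.2
        exact (F.mem_subgroup _ hkI _).1 ((hK _).1 hx _ hkI) _
      · exact hc X (Finset.mem_toRight.2 hk)
    choose S hS using hfin
    refine (typeDefinable_iff D).2 ⟨Set.range fun n => {g | ∀ c : ℕ → M,
      (∀ X : S n, X.1.1 c) → g ∈ F.nbhd n c}, ?_, ?_⟩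
    · rintro _ ⟨n, rfl⟩
      refine DefPred.all ((DefPred.finite_all fun X => ?_).imp ?_)
      · exact (F.conds_def _ X.1.2).comp Sum.inr
      · exact (F.nbhd_def n).mem (DefTerm.var Sum.inl) Sum.inr
    · ext x
      constructor
      · rintro hx _ ⟨n, rfl⟩ c hc
        exact hS n x hx c fun X hX => hc ⟨X, hX⟩
      · intro hx
        exact (hK x).2 fun c hc => (F.mem_subgroup c hc x).2 fun n =>
          hx _ ⟨n, rfl⟩ c fun X => hc _ X.1.2
  · refine StableSub.of_forall fun U hU hKU => ?_
    obtain ⟨S, hS⟩ := exists_finset hM hκ hA hnbhd hU fun x hx =>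
      hKU (hK' x (Set.mem_iInter.1 hx))
    refine ⟨_, (Good.finset_inf hM hκ (fun k : I × ℕ => F.good _ (hIF _ k.1.2)) S).2,
      fun x hx => hS fun k hk => ?_⟩
    simp only [SetLike.mem_coe, Subgroup.mem_iInf] at hx
    exact (F.mem_subgroup _ (hIF _ k.1.2) x).1 (hx k hk) _

end UniformFamily

theorem StableSub.mono {H K : Subgroup G} (hH : D.StableSub H) (hHK : H ≤ K) : D.StableSub K :=
  fun P hP U hU hKU => hH P hP U hU fun _ hx => hKU (hHK hx)

/-- The intersection of a subgroup chain. -/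
def _root_.StableQuotient.IsSubgroupChain.subgroup {U : ℕ → Set G} (hU : IsSubgroupChain U) :
    Subgroup G where
  carrier := ⋂ n, U n
  one_mem' := Set.mem_iInter.2 hU.one_mem
  inv_mem' hx := Set.mem_iInter.2 fun n => hU.inv_mem n _ (Set.mem_iInter.1 hx n)
  mul_mem' hx hy := Set.mem_iInter.2 fun n =>
    hU.mul_mem n _ (Set.mem_iInter.1 hx _) _ (Set.mem_iInter.1 hy _)

theorem _root_.StableQuotient.IsSubgroupChain.mem_subgroup {U : ℕ → Set G}
    (hU : IsSubgroupChain U) {x : G} : x ∈ hU.subgroup ↔ ∀ n, x ∈ U n :=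
  Set.mem_iInter

theorem DefFam.defPred_isSubgroupChain {𝒰 : ℕ → (ℕ → M) → Set G}
    (h𝒰 : ∀ n, D.DefFam A (𝒰 n)) {X : ((ℕ → M) → Prop) → Prop}
    (hX : ∀ p, DefPred L A p → X p) {c₀ : ℕ → M} (hc₀ : IsSubgroupChain fun n => 𝒰 n c₀)
    {c : ℕ → M} (h : ∀ p, X p → p c₀ → p c) : IsSubgroupChain fun n => 𝒰 n c where
  one_mem n := h (fun c => 1 ∈ 𝒰 n c) (hX _ ((h𝒰 n).mem DefTerm.one id)) (hc₀.one_mem n)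
  inv_mem n := by
    refine h (fun c => ∀ x, x ∈ 𝒰 n c → x⁻¹ ∈ 𝒰 n c) (hX _ (DefPred.allG (D := D)
      (DefPred.imp ?_ ?_))) (hc₀.inv_mem n)
    · exact (h𝒰 n).mem (DefTerm.var Sum.inr) Sum.inl
    · exact (h𝒰 n).mem (DefTerm.var Sum.inr).inv Sum.inl
  mul_mem n := by
    have := h (fun c => ∀ x y, x ∈ 𝒰 (n + 1) c ∧ y ∈ 𝒰 (n + 1) c → x * y ∈ 𝒰 n c)
      (hX _ (DefPred.allG (D := D) (DefPred.allG (D := D)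
        (p := fun (z : ℕ ⊕ Fin D.n → M) y => D.rd (z ∘ Sum.inr) ∈ 𝒰 (n + 1) (z ∘ Sum.inl) ∧
          y ∈ 𝒰 (n + 1) (z ∘ Sum.inl) → D.rd (z ∘ Sum.inr) * y ∈ 𝒰 n (z ∘ Sum.inl))
        (DefPred.imp (DefPred.and ?_ ?_) ?_)))) (fun x y hxy => hc₀.mul_mem n x hxy.1 y hxy.2)
    · exact fun x hx y hy => this x y ⟨hx, hy⟩
    · exact (h𝒰 (n + 1)).mem (DefTerm.var (Sum.inl ∘ Sum.inr)) (Sum.inl ∘ Sum.inl)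
    · exact (h𝒰 (n + 1)).mem (DefTerm.var Sum.inr) (Sum.inl ∘ Sum.inl)
    · exact (h𝒰 n).mem ((DefTerm.var (Sum.inl ∘ Sum.inr)).mul (DefTerm.var Sum.inr))
        (Sum.inl ∘ Sum.inl)

theorem Good.exists_chain (hM : IsSaturated L M κ) (hκ : ℵ₀ < κ) {H : Subgroup G}
    (hH : D.Good κ H) {V : Set G} (hV : D.GDef Set.univ V) (hHV : (H : Set G) ⊆ V) :
    ∃ 𝒰 : ℕ → (ℕ → M) → Set G, (∀ n, D.DefFam ∅ (𝒰 n)) ∧ ∃ c : ℕ → M,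
      IsSubgroupChain (fun n => 𝒰 n c) ∧ (∀ n, (H : Set G) ⊆ 𝒰 n c) ∧ 𝒰 0 c ⊆ V := by
  obtain ⟨⟨A, hA, hHA⟩, -⟩ := hH
  let St := {U : Set G // D.GDef Set.univ U ∧ (H : Set G) ⊆ U}
  have step : ∀ U : St, ∃ W : St, (∀ x ∈ W.1, x⁻¹ ∈ W.1) ∧
      ∀ x ∈ W.1, ∀ y ∈ W.1, x * y ∈ U.1 := fun U => by
    obtain ⟨W, hW, hHW, h⟩ := exists_mul_subset hM hκ hA hHA U.2.1 U.2.2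
    exact ⟨⟨W, hW.mono (Set.subset_univ _), hHW⟩, h⟩
  choose next hinv hmul using step
  -- The chain starts at `next V`, since `V` itself need not be symmetric.
  let U : ℕ → St := fun n => next^[n + 1] ⟨V, hV, hHV⟩
  have hU : ∀ n, U (n + 1) = next (U n) := fun n => Function.iterate_succ_apply' _ _ _
  choose 𝒰 h𝒰 a ha using fun n => (U n).2.1.exists_family
  -- The pairing function merges the parameters of all levels into one `ℕ`-tuple.
  refine ⟨fun n c => 𝒰 n fun i => c (Nat.pair n i), fun n => (h𝒰 n).comp (Nat.pair n),
    fun k => a k.unpair.1 k.unpair.2, ?_⟩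
  have hU' : ∀ n, 𝒰 n (fun i => a (Nat.pair n i).unpair.1 (Nat.pair n i).unpair.2) = (U n).1 :=
    fun n => by
      simp only [Nat.unpair_pair]
      exact (ha n).symm
  simp only [hU']
  refine ⟨⟨fun n => (U n).2.2 H.one_mem, fun n => ?_, fun n => ?_⟩, fun n => (U n).2.2,
    fun x hx => ?_⟩
  · cases n with
    | zero => exact hinv _
    | succ n => rw [hU]; exact hinv _
  · rw [hU]
    exact hmul _
  · have := hmul ⟨V, hV, hHV⟩ x hx 1 ((U 0).2.2 H.one_mem)
    rwa [mul_one] at this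

open Classical in
/-- A stable type-definable subgroup contained in a definable set `V` gives rise to a uniform
family having a member contained in `V`. -/
theorem Good.exists_uniformFamily (hM : IsSaturated L M κ) (hκ : ℵ₀ < κ) {H : Subgroup G}
    (hH : D.Good κ H) {V : Set G} (hV : D.GDef Set.univ V) (hHV : (H : Set G) ⊆ V) :
    ∃ F : D.UniformFamily κ, ∃ c ∈ F.index, (F.subgroup c : Set G) ⊆ V := by
  obtain ⟨𝒰, h𝒰, c₀, hchain, hH𝒰, h𝒰V⟩ := hH.exists_chain hM hκ hV hHV
  -- The index set consists of the realizations of the type of `c₀` over `∅`; being a chain is part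
  -- of that type.
  have hch : ∀ c, (∀ X ∈ {X | DefPred L (∅ : Set M) X ∧ X c₀}, X c) →
      IsSubgroupChain fun n => 𝒰 n c := fun c hc =>
    DefFam.defPred_isSubgroupChain h𝒰 (X := DefPred L (∅ : Set M)) (fun _ h => h) hchain
      fun p hp hpc => hc p ⟨hp, hpc⟩
  let K : (ℕ → M) → Subgroup G := fun c =>
    if h : IsSubgroupChain fun n => 𝒰 n c then h.subgroup else ⊤
  have hK : ∀ c, (IsSubgroupChain fun n => 𝒰 n c) → ∀ x, x ∈ K c ↔ ∀ n, x ∈ 𝒰 n c :=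
    fun c h x => by
      simp only [K, dif_pos h]
      exact h.mem_subgroup
  have hst : D.StableSub (K c₀) := hH.2.mono fun x hx => (hK c₀ hchain x).2 fun n => hH𝒰 n hx
  refine ⟨⟨𝒰, h𝒰, {X | DefPred L (∅ : Set M) X ∧ X c₀}, fun X hX => hX.1, K, hch,
    fun c hc => hK c (hch c hc), fun c hc => ?_⟩, c₀, fun X hX => hX.2, fun x hx =>
      h𝒰V ((hK c₀ hchain x).1 hx 0)⟩
  have hA : #(Set.range c) < κ := mk_lt_of_countable hκ (Set.countable_range c)
  have hdef : ∀ n, D.GDef (Set.range c) (𝒰 n c) := fun n =>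
    (h𝒰 n).gdef (Set.empty_subset _) fun i => ⟨i, rfl⟩
  refine ⟨⟨Set.range c, hA, (typeDefinable_iff D).2
    ⟨Set.range fun n => 𝒰 n c, ?_, ?_⟩⟩, fun P hP U hU hKU => ?_⟩
  · rintro _ ⟨n, rfl⟩
    exact hdef n
  · ext x
    simpa using hK c (hch c hc) x
  · obtain ⟨S, hS⟩ := exists_finset hM hκ hA hdef hU fun x hx =>
      hKU ((hK c (hch c hc) x).2 (Set.mem_iInter.1 hx))
    have hsub : 𝒰 (S.sup id) c ⊆ U := fun x hx => hS fun n hn =>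
      (hch c hc).antitone (Finset.le_sup (f := id) hn) hx
    obtain ⟨N, hN⟩ := hst P hP (𝒰 (S.sup id) c₀)
      ((h𝒰 _).gdef (Set.empty_subset _) fun _ => trivial) fun x hx => (hK c₀ hchain x).1 hx _
    -- The family `P` is `∅`-definable, so the absence of patterns of length `N` belongs to the type
    -- of `c₀` and holds for `c` as well.
    exact ⟨N, fun h => hc _ ⟨(defPred_hasOrder hP (h𝒰 _) N).not, hN⟩ (h.mono hsub)⟩

theorem Good.exists_typeDefinable_empty (hM : IsSaturated L M κ) (hκ : ℵ₀ < κ) {T : L.Theory}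
    (hT : IsNIP.{u, v, w} T) [M ⊨ T] {H : Subgroup G} (hH : D.Good κ H) {V : Set G}
    (hV : D.GDef Set.univ V) (hHV : (H : Set G) ⊆ V) :
    ∃ K : Subgroup G, D.TypeDefinable ∅ (K : Set G) ∧ D.StableSub K ∧ (K : Set G) ⊆ V := by
  obtain ⟨F, c, hc, hcV⟩ := hH.exists_uniformFamily hM hκ hV hHV
  obtain ⟨K, hK, hKs, hKF⟩ := F.exists_stable_inter hM hκ hT
  exact ⟨K, hK, hKs, fun x hx => hcV ((hKF x).1 hx c hc)⟩

/-- The smallest type-definable subgroup with a stable space of left cosets. -/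
theorem exists_isLeast_good (hM : IsSaturated L M κ) (hκ : ℵ₀ < κ) {T : L.Theory}
    (hT : IsNIP.{u, v, w} T) [M ⊨ T] (D : DefinableGroup L M G) :
    ∃ K : Subgroup G, D.TypeDefinable ∅ (K : Set G) ∧ IsLeast {H | D.Good κ H} K := by
  let 𝒮 := {K : Subgroup G // D.TypeDefinable ∅ (K : Set G) ∧ D.StableSub K}
  have hemp : #(∅ : Set M) < κ := mk_lt_of_countable hκ Set.countable_empty
  have hK : D.TypeDefinable ∅ ((⨅ K : 𝒮, K.1 : Subgroup G) : Set G) :=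
    typeDefinable_iInf fun K => K.2.1
  refine ⟨⨅ K : 𝒮, K.1, hK, ⟨⟨∅, hemp, hK⟩, StableSub.of_forall fun U hU hKU => ?_⟩, fun H hH => ?_⟩
  · choose 𝒱 h𝒱 hKV using fun K : 𝒮 => (typeDefinable_iff D).1 K.2.1
    obtain ⟨S, hS⟩ := exists_finset hM hκ hemp (ι := Σ K : 𝒮, 𝒱 K) (F := fun i => i.2.1)
      (fun i => h𝒱 i.1 _ i.2.2) hU fun x hx => hKU (by
        rw [SetLike.mem_coe, Subgroup.mem_iInf]
        intro K
        rw [← SetLike.mem_coe, hKV]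
        exact fun V hV => Set.mem_iInter.1 hx ⟨K, V, hV⟩)
    refine ⟨_, (Good.finset_inf hM hκ (K := fun i : Σ K : 𝒮, 𝒱 K => i.1.1)
      (fun i => ⟨⟨∅, hemp, i.1.2.1⟩, i.1.2.2⟩) S).2, fun x hx => hS fun i hi => ?_⟩
    simp only [SetLike.mem_coe, Subgroup.mem_iInf] at hx
    have := hx i hi
    rw [← SetLike.mem_coe, hKV] at this
    exact this _ i.2.2
  · obtain ⟨A, -, hA⟩ := hH.1
    obtain ⟨𝒱, h𝒱, hHV⟩ := (typeDefinable_iff D).1 hA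
    intro x hx
    rw [← SetLike.mem_coe, hHV]
    intro V hV
    obtain ⟨K, hK, hKs, hKV⟩ := hH.exists_typeDefinable_empty hM hκ hT
      ((h𝒱 V hV).mono (Set.subset_univ _)) (hHV ▸ Set.sInter_subset_of_mem hV)
    exact hKV (Subgroup.mem_iInf.1 hx ⟨K, hK, hKs⟩)

end DefinableGroup

end StableQuotient

/-! ### The main theorem -/

theorem theorem1p1 {L : FirstOrder.Language.{u, v}} (T : L.Theory) (hT : T.IsComplete)
    (hNIP : StableQuotient.IsNIP.{u, v, w} T)
    {M : Type w} [L.Structure M] [Nonempty M] [M ⊨ T]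
    (κ : Cardinal.{w}) (hκ : ℵ₀ < κ)
    (hLκ : Cardinal.lift.{w} L.card < Cardinal.lift.{max u v} κ)
    (hM : StableQuotient.IsSaturated L M κ)
    {G : Type w'} [Group G] (D : StableQuotient.DefinableGroup L M G) :
    ∃ Gst : Subgroup G,
      D.TypeDefinable ∅ (Gst : Set G) ∧
      (D.coset Gst).IsStable L κ ∅ ∧
      IsLeast {H : Subgroup G | ∃ A : Set M, #A < κ ∧
        D.TypeDefinable A (H : Set G) ∧ (D.coset H).IsStable L κ A} Gst ∧
      Gst.Normal := by
  obtain ⟨K, hK, hKgood, hKleast⟩ :=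
    StableQuotient.DefinableGroup.exists_isLeast_good hM hκ hNIP D
  have hemp : #(∅ : Set M) < κ :=
    StableQuotient.mk_lt_of_countable hκ Set.countable_empty
  have hst : (D.coset K).IsStable L κ ∅ :=
    StableQuotient.DefinableGroup.isStable_of_stableSub hM hκ hemp hK hKgood.2
  refine ⟨K, hK, hst, ⟨⟨∅, hemp, hK, hst⟩, fun H ⟨A, hA, hHA, hHs⟩ => hKleast
    ⟨⟨A, hA, hHA⟩, StableQuotient.DefinableGroup.stableSub_of_isStable hM hκ hA hHA hHs⟩⟩, ⟨?_⟩⟩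
  intro n hn g
  -- By minimality `K ≤ g⁻¹ * K * g`, so `n = g⁻¹ * m * g` with `m ∈ K`.
  obtain ⟨m, hm, h⟩ := hKleast (hKgood.conj hκ g⁻¹) hn
  obtain rfl : m = g * n * g⁻¹ := by
    rw [← h]
    simp [mul_assoc]
  exact hm
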